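/- Let $p$ be a real polynomial of even degree $n\ge 2$ with positive leading coefficient. For $t\ge 0$ let $p(x,t)=(p*g_t)(x)$, where $g_t(x)=\frac{1}{\sqrt{2\pi t}}e^{-x^2/(2t)}$ is the Gaussian of variance $t$ and $p(x,0)=p(x)$. The Yuille–Poggio equation is $$\frac{dx}{dt}=-\frac{p_{xxx}(x,t)}{2\,p_{xx}(x,t)} .$$ A point $(x,t)$ with $p_{xx}(x,t)=0$ is called singular. For $h\in\mathbb R$ and $T\ge 0$, an integral curve on $[0,T]$ from $h$ is a continuous function $x:[0,T]\to\mathbb R$ with $x(0)=h$ such that $(x(t),t)$ is singular for at most finitely many $t\in(0,T)$ and the equation holds at all other $t\in(0,T)$ (the end point $(x(T),T)$ may be singular). The Yuille–Poggio curve from $(h,0)$ is the set of all points $(x(T),T)$ with $T\ge 0$ and $x$ an integral curve on $[0,T]$ from $h$. The escape zone $\Omega^c$ is the set of all $c\in\mathbb R$ such that the Yuille–Poggio curve from $(c,0)$ is disjoint from the Yuille–Poggio curve from $(c',0)$ for every $c'\ne c$. Let $t_0\ge 0$ be such that $x\mapsto p(x,t_0)$ is convex, let $x^{t_0}_{\min}$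 be a global minimizer of $p(\cdot,t_0)$, and let $x^*$ be a global minimizer of $p$. Say that $x^*$ is reached backward from $x^{t_0}_{\min}$ if there is a continuous function $x:[0,t_0]\to\mathbb R$ with $x(t_0)=x^{t_0}_{\min}$ and $x(0)=x^*$ such that, for every $t\in(0,t_0]$, $p_{xx}(x(t),t)\ne 0$ and $x$ satisfies the Yuille–Poggio equation at $t$ (with the one-sided derivative at $t=t_0$). Then $x^*$ is reached backward from $x^{t_0}_{\min}$ if and only if $x^*\in\Omega^c$. -/

import Mathlib

open MeasureTheory ProbabilityTheory Set Polynomial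

noncomputable section

/-- The heat evolution `p(x,t) = (p * g_t)(x)` of a polynomial, where `g_t` is the centred Gaussian
of variance `t` (the unit point mass at `0` when `t = 0`). Only times `t ≥ 0` are ever used. -/
def heatEvolution (p : ℝ[X]) (t x : ℝ) : ℝ :=
  ∫ y, p.eval (x - y) ∂(gaussianReal 0 t.toNNReal)

/-- The `k`-th spatial derivative `∂ᵏp/∂xᵏ (x,t)` of the heat evolution. -/
def heatDeriv (p : ℝ[X]) (k : ℕ) (t x : ℝ) : ℝ :=
  iteratedDeriv k (heatEvolution p t) x

/-- The right-hand side `-p_xxx / (2 p_xx)` of the Yuille–Poggio equation. It is meaningful only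
where `p_xx ≠ 0`, and it is only used there. -/
def ypVelocity (p : ℝ[X]) (t x : ℝ) : ℝ :=
  -(heatDeriv p 3 t x) / (2 * heatDeriv p 2 t x)

/-- `x` is an integral curve of the Yuille–Poggio equation on `[0,T]` with initial value `h`: a
continuous curve `t ↦ x t` that meets the singular set `p_xx = 0` at no more than finitely many
times of `(0,T)` and solves the equation at all other times of `(0,T)`. The end point `(x T, T)`
may be singular. -/
structure IsYPCurve (p : ℝ[X]) (h T : ℝ) (x : ℝ → ℝ) : Prop where
  continuousOn : ContinuousOn x (Icc 0 T)
  initial : x 0 = h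
  finite_singular : {t ∈ Ioo 0 T | heatDeriv p 2 t (x t) = 0}.Finite
  equation : ∀ t ∈ Ioo 0 T, heatDeriv p 2 t (x t) ≠ 0 →
    HasDerivAt x (ypVelocity p t (x t)) t

/-- The Yuille–Poggio curve from `(h,0)` as a subset of the `(x,t)`-plane. -/
def ypCurve (p : ℝ[X]) (h : ℝ) : Set (ℝ × ℝ) :=
  {z | 0 ≤ z.2 ∧ ∃ x : ℝ → ℝ, IsYPCurve p h z.2 x ∧ x z.2 = z.1}

/-- The escape zone: starting points whose Yuille–Poggio curve meets no Yuille–Poggio curve from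
another starting point. -/
def escapeZone (p : ℝ[X]) : Set ℝ :=
  {c | ∀ c', c' ≠ c → Disjoint (ypCurve p c) (ypCurve p c')}

/-- The confinement zone, the complement of the escape zone. -/
def confinementZone (p : ℝ[X]) : Set ℝ := (escapeZone p)ᶜ

/-- Following the Yuille–Poggio equation backward in time from the point `a` at time `t₀` leads to
the point `b` at time `0`: there is a curve, continuous on `[0,t₀]`, from `b` to `a` which solves
the (nonsingular) equation on `(0,t₀]`. The equation may be singular at `(b,0)` itself. -/
def ReachedBackward (p : ℝ[X]) (t₀ a b : ℝ) : Prop :=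
  ∃ x : ℝ → ℝ, ContinuousOn x (Icc 0 t₀) ∧ x t₀ = a ∧ x 0 = b ∧
    ∀ t ∈ Ioc 0 t₀, heatDeriv p 2 t (x t) ≠ 0 ∧
      HasDerivWithinAt x (ypVelocity p t (x t)) (Icc 0 t₀) t

end

open Filter Topology

/-!
# Backward Yuille–Poggio trajectories and the escape zone

Convolving a polynomial with the Gaussian of variance `t` amounts to applying the finite sum
`exp ((t / 2) ∂ₓ²)`, so `u = p_x` is a polynomial solution of the heat equation
`u_t = u_xx / 2` (`heatEvolution_eq_heatVal`, `hasDerivAt_heatVal_time`). Hence `u` is constant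
along Yuille–Poggio curves, and conversely every continuous curve of zeros of `u` is such a curve
(`IsYPCurve.heatVal_derivative_eq`, `ZeroBranch.isYPCurve`): multiple zeros of `u` occur at only
finitely many times of a bounded interval (`finite_singularTimes`). The theorem is therefore about
the branches of `{u = 0}` that emanate from `xstar` and the ones that end at the unique zero `xmin`
of `u(·, t₀)`.

Points are written as (time, position), the order of arguments of `heatVal`. At the minimizer
`xstar` the polynomial `p''` vanishes to even order with positive leading coefficient, so `u_x > 0`
near `(0, xstar)` for small `t > 0` (`eventually_heatVal_pos_of_even`), and only one branch starts at `xstar`. If it can be followed without singularities back from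
`(t₀, xmin)`, uniqueness of branches through regular zeros (`RegularFamily.eqOn_of_regular`) forces
every curve that meets it to start at `xstar`.

Otherwise the branch from `xstar` runs into a multiple zero `(s, c)` of `u`
(`exists_branch_from_minimizer`). Just before `s` there is another zero of `u` near `c`
(`eventually_exists_other_zero`). It lies on a branch that ends at `(s, c)` and, followed backward
to time `0` (`exists_branch_backward`), starts at a point other than `xstar`; so `xstar` is not in
the escape zone.

The local picture before a multiple zero rests on one observation. A nearby critical point of `u`,
followed forward in time to `(s, c)`, has a critical value which changes at the rate `u_xx / 2` and
ends at `0`; hence `u` and `u_xx` have opposite signs there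
(`eventually_critical_value_of_regular_derivative`). By induction on the order of the zero this
shows that multiple zeros are isolated, and it locates the additional zeros.
-/

/-! ### The heat flow on polynomials -/

/-- The heat flow on polynomials, `exp ((t / 2) ∂ₓ²) q = ∑ⱼ tʲ / (2ʲ j!) q⁽²ʲ⁾`, as a finite sum;
it makes sense for all real `t`, also negative ones. -/
noncomputable def heatPoly (q : ℝ[X]) (t : ℝ) : ℝ[X] :=
  ∑ j ∈ Finset.range (q.natDegree + 1), C (t ^ j / (2 ^ j * j.factorial)) * derivative^[2 * j] q

/-- The value at `x` of the polynomial heat flow of `q` at time `t`. -/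
noncomputable def heatVal (q : ℝ[X]) (t x : ℝ) : ℝ := (heatPoly q t).eval x

theorem heatPoly_eq_sum {q : ℝ[X]} {N : ℕ} (h : q.natDegree < N) (t : ℝ) :
    heatPoly q t =
      ∑ j ∈ Finset.range N, C (t ^ j / (2 ^ j * j.factorial)) * derivative^[2 * j] q := by
  refine Finset.sum_subset (by simpa using Nat.succ_le_of_lt h) fun j _ hj => ?_
  rw [iterate_derivative_eq_zero (by simp at hj; lia), mul_zero]

theorem heatPoly_derivative (q : ℝ[X]) (t : ℝ) :
    heatPoly (derivative q) t = derivative (heatPoly q t) := by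
  rw [heatPoly_eq_sum (N := q.natDegree + 1)
    (lt_of_le_of_lt (natDegree_derivative_le q) (by lia)), heatPoly, derivative_sum]
  refine Finset.sum_congr rfl fun j _ => ?_
  rw [derivative_C_mul, ← Function.iterate_succ_apply, ← Function.iterate_succ_apply' derivative]

theorem heatPoly_neg (q : ℝ[X]) (t : ℝ) : heatPoly (-q) t = -heatPoly q t := by
  simp [heatPoly]

theorem heatVal_neg (q : ℝ[X]) (t x : ℝ) : heatVal (-q) t x = -heatVal q t x := by
  simp [heatVal, heatPoly_neg]

theorem heatPoly_time_zero (q : ℝ[X]) : heatPoly q 0 = q := by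
  rw [heatPoly, Finset.sum_range_succ']
  simp

theorem heatVal_eq_sum {q : ℝ[X]} {N : ℕ} (h : q.natDegree < N) (t x : ℝ) :
    heatVal q t x =
      ∑ j ∈ Finset.range N, t ^ j / (2 ^ j * j.factorial) * (derivative^[2 * j] q).eval x := by
  simp [heatVal, heatPoly_eq_sum h, eval_finsetSum]

theorem continuous_heatVal (q : ℝ[X]) : Continuous fun z : ℝ × ℝ => heatVal q z.1 z.2 := by
  simp only [heatVal_eq_sum (Nat.lt_succ_self q.natDegree)]
  refine continuous_finsetSum _ fun j _ => ?_
  have := (derivative^[2 * j] q).continuous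
  fun_prop

theorem hasDerivAt_heatVal (q : ℝ[X]) (t x : ℝ) :
    HasDerivAt (heatVal q t) (heatVal (derivative q) t x) x := by
  rw [heatVal, heatPoly_derivative]
  exact (heatPoly q t).hasDerivAt x

/-- The heat equation `u_t = u_xx / 2`. -/
theorem hasDerivAt_heatVal_time (q : ℝ[X]) (t x : ℝ) :
    HasDerivAt (fun τ => heatVal q τ x) (heatVal (derivative (derivative q)) t x / 2) t := by
  have hN : q.natDegree < q.natDegree + 1 := Nat.lt_succ_self _
  have hN' : (derivative (derivative q)).natDegree < q.natDegree + 1 :=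
    lt_of_le_of_lt ((natDegree_derivative_le _).trans (Nat.sub_le_sub_right
      (natDegree_derivative_le q) 1)) (by lia)
  simp only [heatVal_eq_sum hN, heatVal_eq_sum hN']
  have key : ∀ j : ℕ, HasDerivAt
      (fun τ : ℝ => τ ^ j / (2 ^ j * j.factorial) * (derivative^[2 * j] q).eval x)
      (j * t ^ (j - 1) / (2 ^ j * j.factorial) * (derivative^[2 * j] q).eval x) t := fun j =>
    ((hasDerivAt_pow j t).div_const _).mul_const _
  refine (HasDerivAt.fun_sum fun j _ => key j).congr_deriv ?_
  rw [Finset.sum_range_succ', Finset.sum_range_succ (fun j => t ^ j / (2 ^ j * j.factorial) *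
    (derivative^[2 * j] (derivative (derivative q))).eval x), add_div, Finset.sum_div]
  have h0 : derivative^[2 * q.natDegree] (derivative (derivative q)) = 0 := by
    rw [← Function.iterate_succ_apply, ← Function.iterate_succ_apply]
    exact iterate_derivative_eq_zero (by lia)
  rw [h0]
  simp only [Nat.cast_zero, zero_mul, zero_div, add_zero, eval_zero, mul_zero]
  refine Finset.sum_congr rfl fun j _ => ?_
  have h1 : derivative^[2 * (j + 1)] q = derivative^[2 * j] (derivative (derivative q)) := by
    rw [← Function.iterate_succ_apply, ← Function.iterate_succ_apply]; rfl
  rw [h1, Nat.factorial_succ, pow_succ, Nat.add_sub_cancel]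
  push_cast
  field_simp

theorem coeff_heatPoly_natDegree (q : ℝ[X]) (t : ℝ) :
    (heatPoly q t).coeff q.natDegree = q.leadingCoeff := by
  rw [heatPoly, finsetSum_coeff, Finset.sum_eq_single 0]
  · simp
  · intro j _ hj
    rw [coeff_C_mul, coeff_iterate_derivative,
      coeff_eq_zero_of_natDegree_lt (by lia : q.natDegree < q.natDegree + 2 * j)]
    simp
  · simp

theorem natDegree_heatPoly_le (q : ℝ[X]) (t : ℝ) : (heatPoly q t).natDegree ≤ q.natDegree := by
  refine natDegree_sum_le_of_forall_le _ _ fun j _ => (natDegree_C_mul_le _ _).trans ?_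
  exact (natDegree_iterate_derivative q _).trans (Nat.sub_le _ _)

theorem heatPoly_ne_zero {q : ℝ[X]} (hq : q ≠ 0) (t : ℝ) : heatPoly q t ≠ 0 := fun h => by
  have := coeff_heatPoly_natDegree q t
  rw [h, coeff_zero] at this
  exact hq (leadingCoeff_eq_zero.1 this.symm)

/-- On a bounded time interval the zeros of the heat flow of a nonzero polynomial stay in a bounded
set, because the leading coefficient does not depend on time. -/
theorem exists_bound_heatVal_zeros {q : ℝ[X]} (hq : q ≠ 0) (a b : ℝ) :
    ∃ M, 0 < M ∧ ∀ t ∈ Icc a b, ∀ x, heatVal q t x = 0 → |x| < M := by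
  have hc : ∀ i, Continuous fun t => (heatPoly q t).coeff i := fun i => by
    simp only [heatPoly, finsetSum_coeff, coeff_C_mul]
    fun_prop
  have hB : ∀ i, ∃ B : ℝ, ∀ t ∈ Icc a b, ‖(heatPoly q t).coeff i‖ ≤ B := fun i =>
    isCompact_Icc.exists_bound_of_continuousOn (hc i).continuousOn
  choose B hB using hB
  let K : ℝ := (∑ i ∈ Finset.range q.natDegree, |B i|) / ‖q.leadingCoeff‖ + 1
  refine ⟨K, by positivity, fun t ht x hx => ?_⟩
  have hdeg : (heatPoly q t).natDegree = q.natDegree :=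
    le_antisymm (natDegree_heatPoly_le q t) (le_natDegree_of_ne_zero
      (by rw [coeff_heatPoly_natDegree]; exact leadingCoeff_ne_zero.2 hq))
  have hroot : |x| < ((heatPoly q t).cauchyBound : ℝ) :=
    NNReal.coe_lt_coe.2 (IsRoot.norm_lt_cauchyBound (heatPoly_ne_zero hq t) hx)
  refine hroot.trans_le ?_
  rw [cauchyBound, NNReal.coe_add, NNReal.coe_div, NNReal.coe_one]
  have hl : (heatPoly q t).leadingCoeff = q.leadingCoeff := by
    rw [leadingCoeff, hdeg, coeff_heatPoly_natDegree]
  rw [hl, coe_nnnorm, hdeg]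
  have : (((Finset.range q.natDegree).sup fun i => ‖(heatPoly q t).coeff i‖₊ : NNReal) : ℝ) ≤
      ∑ i ∈ Finset.range q.natDegree, |B i| := by
    rw [← NNReal.coe_mk (∑ i ∈ Finset.range q.natDegree, |B i|)
      (Finset.sum_nonneg fun i _ => abs_nonneg _), NNReal.coe_le_coe]
    refine Finset.sup_le fun i hi => ?_
    rw [← NNReal.coe_le_coe, coe_nnnorm, NNReal.coe_mk]
    exact ((hB i t ht).trans (le_abs_self _)).trans
      (Finset.single_le_sum (f := fun i => |B i|) (fun i _ => abs_nonneg _) hi)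
  exact add_le_add_left (div_le_div_of_nonneg_right this (norm_nonneg _)) 1

/-! ### Gaussian moments and convolution with the heat kernel -/

theorem integrable_pow_gaussianReal (v : NNReal) (n : ℕ) :
    Integrable (fun y : ℝ => y ^ n) (gaussianReal 0 v) := by
  have h := (memLp_id_gaussianReal (μ := 0) (v := v) n).integrable_norm_pow'
  refine h.mono' (by fun_prop) (ae_of_all _ fun y => ?_)
  simp

theorem integrable_pow_mul_gaussianPDFReal {v : NNReal} (hv : v ≠ 0) (n : ℕ) :
    Integrable fun y : ℝ => y ^ n * gaussianPDFReal 0 v y := by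
  have h := integrable_pow_gaussianReal v n
  rw [gaussianReal_of_var_ne_zero 0 hv, integrable_withDensity_iff_integrable_smul'
    (measurable_gaussianPDF 0 v) (ae_of_all _ fun _ => gaussianPDF_lt_top)] at h
  simpa [toReal_gaussianPDF, mul_comm] using h

theorem hasDerivAt_gaussianPDFReal (v : NNReal) (y : ℝ) :
    HasDerivAt (gaussianPDFReal 0 v) (-(y / v) * gaussianPDFReal 0 v y) y := by
  have h := ((((hasDerivAt_id y).sub_const 0).pow 2).neg.div_const (2 * (v : ℝ))).exp.const_mul
    (√(2 * Real.pi * v))⁻¹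
  refine h.congr_deriv ?_
  simp only [gaussianPDFReal, id, Pi.pow_apply, Pi.neg_apply]
  by_cases hv : (v : ℝ) = 0
  · simp [hv]
  · push_cast
    field_simp
    ring

/-- Integration by parts turns the Gaussian moments into a two-step recursion. -/
theorem integral_pow_add_two_gaussianReal (v : NNReal) (n : ℕ) :
    ∫ y, y ^ (n + 2) ∂(gaussianReal 0 v) = v * (n + 1) * ∫ y, y ^ n ∂(gaussianReal 0 v) := by
  by_cases hv : v = 0
  · simp [hv, gaussianReal_zero_var]
  have hv' : (v : ℝ) ≠ 0 := by simpa using hv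
  have hd : ∀ y : ℝ, HasDerivAt (fun y => y ^ (n + 1) * gaussianPDFReal 0 v y)
      ((n + 1) * (y ^ n * gaussianPDFReal 0 v y)
        - (v : ℝ)⁻¹ * (y ^ (n + 2) * gaussianPDFReal 0 v y)) y := fun y =>
    ((hasDerivAt_pow (n + 1) y).mul (hasDerivAt_gaussianPDFReal v y)).congr_deriv (by
      push_cast; field_simp; ring)
  have hi := integrable_pow_mul_gaussianPDFReal hv
  have h0 := integral_eq_zero_of_hasDerivAt_of_integrable hd
    (((hi n).const_mul _).sub ((hi (n + 2)).const_mul _)) (hi (n + 1))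
  rw [integral_sub ((hi n).const_mul _) ((hi (n + 2)).const_mul _), integral_const_mul,
    integral_const_mul] at h0
  rw [integral_gaussianReal_eq_integral_smul hv, integral_gaussianReal_eq_integral_smul hv]
  simp only [smul_eq_mul, mul_comm (gaussianPDFReal 0 v _)]
  field_simp at h0
  linarith

theorem integral_pow_even_gaussianReal (v : NNReal) (j : ℕ) :
    ∫ y, y ^ (2 * j) ∂(gaussianReal 0 v) =
      (v : ℝ) ^ j / (2 ^ j * j.factorial) * (2 * j).factorial := by
  induction j with
  | zero => simp
  | succ j ih =>
    rw [mul_add, mul_one, integral_pow_add_two_gaussianReal, ih, Nat.factorial_succ,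
      Nat.factorial_succ, Nat.factorial_succ]
    push_cast
    field_simp
    ring

theorem integral_pow_odd_gaussianReal (v : NNReal) (j : ℕ) :
    ∫ y, y ^ (2 * j + 1) ∂(gaussianReal 0 v) = 0 := by
  induction j with
  | zero => simp
  | succ j ih =>
    rw [show 2 * (j + 1) + 1 = 2 * j + 1 + 2 by ring, integral_pow_add_two_gaussianReal, ih,
      mul_zero]

theorem integral_eval_gaussianReal (q : ℝ[X]) (v : NNReal) :
    ∫ y, q.eval y ∂(gaussianReal 0 v) = heatVal q v 0 := by
  have hN : q.natDegree < 2 * (q.natDegree + 1) := by lia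
  rw [heatVal_eq_sum (N := q.natDegree + 1) (Nat.lt_succ_self _)]
  simp only [eval_eq_sum_range' hN]
  rw [integral_finsetSum _ fun i _ => (integrable_pow_gaussianReal v i).const_mul _]
  simp only [integral_const_mul]
  generalize q.natDegree + 1 = N
  induction N with
  | zero => simp
  | succ N ih =>
    rw [mul_add, mul_one, Finset.sum_range_succ, Finset.sum_range_succ, Finset.sum_range_succ, ih,
      integral_pow_odd_gaussianReal, integral_pow_even_gaussianReal, mul_zero, add_zero,
      ← coeff_zero_eq_eval_zero, coeff_iterate_derivative, zero_add, Nat.descFactorial_self,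
      nsmul_eq_mul]
    ring

theorem iterate_derivative_comp_C_sub_X (q : ℝ[X]) (x : ℝ) (k : ℕ) :
    derivative^[k] (q.comp (C x - X)) = (-1) ^ k * (derivative^[k] q).comp (C x - X) := by
  induction k with
  | zero => simp
  | succ k ih =>
    rw [Function.iterate_succ_apply', ih, Function.iterate_succ_apply',
      ← C_1, ← C_neg, ← C_pow, derivative_C_mul, derivative_comp]
    simp [pow_succ]

/-- Convolution with the Gaussian of variance `t ≥ 0` is the polynomial heat flow. -/
theorem heatEvolution_eq_heatVal (p : ℝ[X]) {t : ℝ} (ht : 0 ≤ t) :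
    heatEvolution p t = heatVal p t := by
  funext x
  have h := integral_eval_gaussianReal (p.comp (C x - X)) t.toNNReal
  rw [Real.coe_toNNReal t ht] at h
  simp only [eval_comp, eval_sub, eval_C, eval_X] at h
  have hN : (p.comp (C x - X)).natDegree < p.natDegree + 1 := by
    refine Nat.lt_succ_of_le (natDegree_comp_le.trans ?_)
    refine (Nat.mul_le_mul_left _ (natDegree_sub_le _ _)).trans ?_
    simp
  rw [heatEvolution, h, heatVal_eq_sum hN, heatVal_eq_sum (Nat.lt_succ_self _)]
  refine Finset.sum_congr rfl fun j _ => ?_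
  rw [iterate_derivative_comp_C_sub_X]
  simp [eval_comp]

theorem heatDeriv_eq_heatVal (p : ℝ[X]) (k : ℕ) {t : ℝ} (ht : 0 ≤ t) (x : ℝ) :
    heatDeriv p k t x = heatVal (derivative^[k] p) t x := by
  rw [heatDeriv, heatEvolution_eq_heatVal p ht]
  induction k generalizing p with
  | zero => simp
  | succ k ih =>
    have : deriv (heatVal p t) = heatVal (derivative p) t :=
      funext fun y => (hasDerivAt_heatVal p t y).deriv
    rw [iteratedDeriv_succ', this, ih, Function.iterate_succ_apply]

/-! ### Branches of zeros in one-parameter families of functions -/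

/-- A family `F t` of functions of `x`, jointly continuous together with its `x`-derivative `G`, in
which every `F t` has isolated zeros. The class is stable under reversing time. -/
structure RegularFamily (F G : ℝ → ℝ → ℝ) : Prop where
  continuous : Continuous fun z : ℝ × ℝ => F z.1 z.2
  continuous_deriv : Continuous fun z : ℝ × ℝ => G z.1 z.2
  hasDerivAt : ∀ t x, HasDerivAt (F t) (G t x) x
  isolated : ∀ t c, ∀ᶠ x in 𝓝[≠] c, F t x ≠ 0

/-- A continuous curve of zeros of the family `F` over the time set `I`. -/
structure ZeroBranch (F : ℝ → ℝ → ℝ) (I : Set ℝ) (y : ℝ → ℝ) : Prop where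
  continuousOn : ContinuousOn y I
  zero : ∀ t ∈ I, F t (y t) = 0

theorem ZeroBranch.mono {F : ℝ → ℝ → ℝ} {I J : Set ℝ} {y : ℝ → ℝ} (h : ZeroBranch F I y)
    (hJ : J ⊆ I) : ZeroBranch F J y :=
  ⟨h.continuousOn.mono hJ, fun t ht => h.zero t (hJ ht)⟩

theorem ZeroBranch.congr {F : ℝ → ℝ → ℝ} {I : Set ℝ} {y z : ℝ → ℝ} (h : ZeroBranch F I y)
    (hz : EqOn z y I) : ZeroBranch F I z :=
  ⟨h.continuousOn.congr hz, fun t ht => by rw [hz ht]; exact h.zero t ht⟩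

theorem ZeroBranch.union {F : ℝ → ℝ → ℝ} {I J : Set ℝ} {y : ℝ → ℝ} (hI : ZeroBranch F I y)
    (hJ : ZeroBranch F J y) (hcI : IsClosed I) (hcJ : IsClosed J) : ZeroBranch F (I ∪ J) y :=
  ⟨hI.continuousOn.union_of_isClosed hJ.continuousOn hcI hcJ,
    fun t ht => ht.elim (hI.zero t) (hJ.zero t)⟩

theorem ZeroBranch.exists_glue {F : ℝ → ℝ → ℝ} {a b c : ℝ} {y z : ℝ → ℝ} (hab : a ≤ b)
    (hbc : b ≤ c) (hy : ZeroBranch F (Icc a b) y) (hz : ZeroBranch F (Icc b c) z)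
    (h : y b = z b) :
    ∃ w, ZeroBranch F (Icc a c) w ∧ EqOn w y (Icc a b) ∧ EqOn w z (Icc b c) := by
  have h1 : EqOn (fun t => if t ≤ b then y t else z t) y (Icc a b) := fun t ht => if_pos ht.2
  have h2 : EqOn (fun t => if t ≤ b then y t else z t) z (Icc b c) := fun t ht => by
    rcases ht.1.eq_or_lt with rfl | hlt
    · simp [h]
    · exact if_neg (not_le.2 hlt)
  refine ⟨_, ?_, h1, h2⟩
  rw [← Icc_union_Icc_eq_Icc hab hbc]
  exact (hy.congr h1).union (hz.congr h2) isClosed_Icc isClosed_Icc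

namespace RegularFamily

variable {F G : ℝ → ℝ → ℝ}

theorem neg (h : RegularFamily F G) :
    RegularFamily (fun t x => -F t x) (fun t x => -G t x) where
  continuous := h.continuous.neg
  continuous_deriv := h.continuous_deriv.neg
  hasDerivAt t x := (h.hasDerivAt t x).neg
  isolated t c := (h.isolated t c).mono fun _ hx => neg_ne_zero.2 hx

theorem reverse (h : RegularFamily F G) :
    RegularFamily (fun t => F (-t)) (fun t => G (-t)) where
  continuous := h.continuous.comp (continuous_fst.neg.prodMk continuous_snd)
  continuous_deriv := h.continuous_deriv.comp (continuous_fst.neg.prodMk continuous_snd)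
  hasDerivAt t x := h.hasDerivAt (-t) x
  isolated t c := h.isolated (-t) c

theorem continuous_space (h : RegularFamily F G) (t : ℝ) : Continuous (F t) :=
  h.continuous.comp (continuous_const.prodMk continuous_id)

theorem continuous_time (h : RegularFamily F G) (x : ℝ) : Continuous fun t => F t x :=
  h.continuous.comp (continuous_id.prodMk continuous_const)

theorem exists_box_deriv_ne_zero (h : RegularFamily F G) {s c : ℝ} (hG : G s c ≠ 0) :
    ∃ ε > 0, ∀ t x, |t - s| < ε → |x - c| < ε → G t x ≠ 0 := by
  have h1 : ∀ᶠ z : ℝ × ℝ in 𝓝 (s, c), G z.1 z.2 ≠ 0 :=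
    h.continuous_deriv.continuousAt.eventually_ne hG
  obtain ⟨ε, hε, H⟩ := Metric.eventually_nhds_iff.1 h1
  refine ⟨ε, hε, fun t x ht hx => H (y := (t, x)) ?_⟩
  rw [Prod.dist_eq, max_lt_iff]
  exact ⟨ht, hx⟩

/-- Rolle: near a point where `G ≠ 0` the functions `F t` are injective. -/
theorem exists_locally_injective (h : RegularFamily F G) {s c : ℝ} (hG : G s c ≠ 0) :
    ∃ ε > 0, ∀ t, |t - s| < ε → ∀ x x', |x - c| < ε → |x' - c| < ε → F t x = F t x' → x = x' := by
  obtain ⟨ε, hε, H⟩ := h.exists_box_deriv_ne_zero hG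
  have key : ∀ t, |t - s| < ε → ∀ x x', |x - c| < ε → |x' - c| < ε → F t x = F t x' → ¬ x < x' := by
    intro t ht x x' hx hx' hF hlt
    obtain ⟨ξ, hξ, h0⟩ := exists_hasDerivAt_eq_zero hlt (h.continuous_space t).continuousOn hF
      fun y _ => h.hasDerivAt t y
    refine H t ξ ht ?_ h0
    rw [abs_lt] at hx hx' ⊢
    constructor <;> linarith [hξ.1, hξ.2]
  refine ⟨ε, hε, fun t ht x x' hx hx' hF => ?_⟩
  exact le_antisymm (not_lt.1 (key t ht x' x hx' hx hF.symm)) (not_lt.1 (key t ht x x' hx hx' hF))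

/-- A branch along which `G ≠ 0` is determined by its value at one time. -/
theorem eqOn_of_regular (h : RegularFamily F G) {I : Set ℝ} (hI : IsPreconnected I)
    {x y : ℝ → ℝ} (hx : ZeroBranch F I x) (hy : ZeroBranch F I y)
    (hG : ∀ t ∈ I, G t (x t) ≠ 0) {t₁ : ℝ} (ht₁ : t₁ ∈ I) (h1 : x t₁ = y t₁) : EqOn x y I := by
  intro t ht
  refine (hI.induction₂ (fun τ τ' => (x τ = y τ ↔ x τ' = y τ')) ?_ ?_ ?_ ht₁ ht).1 h1
  · intro τ hτ
    by_cases he : x τ = y τ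
    · obtain ⟨ε, hε, H⟩ := h.exists_locally_injective (hG τ hτ)
      have e1 : ∀ᶠ τ' in 𝓝[I] τ, |x τ' - x τ| < ε :=
        (hx.continuousOn τ hτ).eventually (Metric.ball_mem_nhds (x τ) hε)
      have e2 : ∀ᶠ τ' in 𝓝[I] τ, |y τ' - x τ| < ε := by
        rw [he]
        exact (hy.continuousOn τ hτ).eventually (Metric.ball_mem_nhds (y τ) hε)
      have e3 : ∀ᶠ τ' in 𝓝[I] τ, |τ' - τ| < ε :=
        mem_nhdsWithin_of_mem_nhds (Metric.ball_mem_nhds τ hε)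
      filter_upwards [e1, e2, e3, self_mem_nhdsWithin] with τ' a1 a2 a3 a4
      exact iff_of_true he
        (H τ' a3 _ _ a1 a2 (by rw [hx.zero τ' a4, hy.zero τ' a4]))
    · have : ∀ᶠ τ' in 𝓝[I] τ, x τ' - y τ' ≠ 0 :=
        ((hx.continuousOn τ hτ).sub (hy.continuousOn τ hτ)).eventually_ne (sub_ne_zero.2 he)
      filter_upwards [this] with τ' a
      exact iff_of_false he (sub_ne_zero.1 a)
  · intro _ _ _ _ _ _ h1 h2
    exact h1.trans h2
  · intro _ _ _ _ h1
    exact h1.symm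

/-- The implicit function theorem at a regular zero, for a family that need not be differentiable
in time. -/
theorem exists_local_branch (h : RegularFamily F G) {s c : ℝ} (hF : F s c = 0) (hG : G s c ≠ 0) :
    ∃ ε > 0, ∃ φ, ZeroBranch F (Icc (s - ε) (s + ε)) φ ∧ φ s = c := by
  wlog hpos : 0 < G s c generalizing F G
  · obtain ⟨ε, hε, φ, hφ, hs⟩ := this h.neg (by simpa using hF) (by simpa using hG)
      (neg_pos.2 (lt_of_le_of_ne (not_lt.1 hpos) hG))
    exact ⟨ε, hε, φ, ⟨hφ.continuousOn, fun t ht => neg_eq_zero.1 (hφ.zero t ht)⟩, hs⟩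
  have h1 : ∀ᶠ z : ℝ × ℝ in 𝓝 (s, c), 0 < G z.1 z.2 :=
    h.continuous_deriv.continuousAt.eventually_const_lt hpos
  obtain ⟨η, hη, H⟩ := Metric.eventually_nhds_iff.1 h1
  have hmono : ∀ t, |t - s| < η → StrictMonoOn (F t) (Icc (c - η / 2) (c + η / 2)) := by
    intro t ht
    refine strictMonoOn_of_deriv_pos (convex_Icc _ _) (h.continuous_space t).continuousOn
      fun x hx => ?_
    rw [(h.hasDerivAt t x).deriv]
    rw [interior_Icc] at hx
    refine H (y := (t, x)) ?_
    rw [Prod.dist_eq, max_lt_iff]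
    refine ⟨ht, ?_⟩
    rw [Real.dist_eq, abs_lt]
    constructor <;> linarith [hx.1, hx.2]
  have hlo : F s (c - η / 2) < 0 := by
    rw [← hF]
    exact hmono s (by simpa using hη) ⟨le_rfl, by linarith⟩ ⟨by linarith, by linarith⟩ (by linarith)
  have hhi : 0 < F s (c + η / 2) := by
    rw [← hF]
    exact hmono s (by simpa using hη) ⟨by linarith, by linarith⟩ ⟨by linarith, le_rfl⟩ (by linarith)
  have e1 : ∀ᶠ t in 𝓝 s, F t (c - η / 2) < 0 ∧ 0 < F t (c + η / 2) ∧ |t - s| < η :=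
    ((h.continuous_time _).continuousAt.eventually_lt_const hlo).and
      (((h.continuous_time _).continuousAt.eventually_const_lt hhi).and
        (Metric.ball_mem_nhds s hη))
  obtain ⟨ε, hε, He⟩ := (nhds_basis_Icc_pos s).eventually_iff.1 e1
  have hex : ∀ t, ∃ x, t ∈ Icc (s - ε) (s + ε) → x ∈ Ioo (c - η / 2) (c + η / 2) ∧ F t x = 0 := by
    intro t
    by_cases ht : t ∈ Icc (s - ε) (s + ε)
    · obtain ⟨x, hx, h0⟩ := intermediate_value_Ioo (by linarith : c - η / 2 ≤ c + η / 2)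
        (h.continuous_space t).continuousOn ⟨(He ht).1, (He ht).2.1⟩
      exact ⟨x, fun _ => ⟨hx, h0⟩⟩
    · exact ⟨0, fun h => absurd h ht⟩
  choose φ hφ using hex
  have hmem : ∀ t ∈ Icc (s - ε) (s + ε), φ t ∈ Icc (c - η / 2) (c + η / 2) := fun t ht =>
    Ioo_subset_Icc_self (hφ t ht).1
  refine ⟨ε, hε, φ, ⟨fun t ht => ?_, fun t ht => (hφ t ht).2⟩, ?_⟩
  · refine tendsto_order.2 ⟨fun a ha => ?_, fun a ha => ?_⟩
    · by_cases hac : a ≤ c - η / 2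
      · filter_upwards [self_mem_nhdsWithin] with τ hτ
        exact hac.trans_lt (hφ τ hτ).1.1
      have ham : a ∈ Icc (c - η / 2) (c + η / 2) := ⟨(not_le.1 hac).le, ha.le.trans (hmem t ht).2⟩
      have hneg : F t a < 0 := by
        rw [← (hφ t ht).2]
        exact hmono t (He ht).2.2 ham (hmem t ht) ha
      filter_upwards [self_mem_nhdsWithin, mem_nhdsWithin_of_mem_nhds
        ((h.continuous_time a).continuousAt.eventually_lt_const hneg)] with τ hτ hτ'
      refine ((hmono τ (He hτ).2.2).lt_iff_lt ham (hmem τ hτ)).1 ?_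
      rwa [(hφ τ hτ).2]
    · by_cases hac : c + η / 2 ≤ a
      · filter_upwards [self_mem_nhdsWithin] with τ hτ
        exact (hφ τ hτ).1.2.trans_le hac
      have ham : a ∈ Icc (c - η / 2) (c + η / 2) := ⟨(hmem t ht).1.trans ha.le, (not_le.1 hac).le⟩
      have hpos' : 0 < F t a := by
        rw [← (hφ t ht).2]
        exact hmono t (He ht).2.2 (hmem t ht) ham ha
      filter_upwards [self_mem_nhdsWithin, mem_nhdsWithin_of_mem_nhds
        ((h.continuous_time a).continuousAt.eventually_const_lt hpos')] with τ hτ hτ'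
      refine ((hmono τ (He hτ).2.2).lt_iff_lt (hmem τ hτ) ham).1 ?_
      rwa [(hφ τ hτ).2]
  · have hs : s ∈ Icc (s - ε) (s + ε) := ⟨by linarith, by linarith⟩
    refine (hmono s (He hs).2.2).injOn (hmem s hs) ⟨by linarith, by linarith⟩ ?_
    rw [(hφ s hs).2, hF]

/-- A bounded branch over `[t₁, s)` converges: its cluster values at `s` are isolated zeros of
`F s`, and the branch cannot oscillate across the zero-free levels that separate them. -/
theorem exists_tendsto_of_branch (h : RegularFamily F G) {t₁ s α β : ℝ} (hs : t₁ < s) {y : ℝ → ℝ}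
    (hy : ZeroBranch F (Ico t₁ s) y) (hb : ∀ t ∈ Ico t₁ s, y t ∈ Icc α β) :
    ∃ c ∈ Icc α β, F s c = 0 ∧ Tendsto y (𝓝[<] s) (𝓝 c) := by
  have hI : ∀ᶠ t in 𝓝[<] s, t ∈ Ico t₁ s := Ico_mem_nhdsLT hs
  obtain ⟨c, hc, hcl⟩ := isCompact_Icc.exists_mapClusterPt (f := 𝓝[<] s) (u := y)
    (tendsto_principal.2 (hI.mono hb))
  have hlim : Tendsto y (𝓝[<] s) (𝓝 c) := by
    refine tendsto_order.2 ?_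
    have key : ∀ e > 0, ∀ᶠ t in 𝓝[<] s, c - e < y t ∧ y t < c + e := by
      intro e he
      have hL : ∀ᶠ x in 𝓝[<] c, F s x ≠ 0 ∧ x ∈ Ioo (c - e) c :=
        ((h.isolated s c).filter_mono (nhdsWithin_mono c fun x hx => ne_of_lt hx)).and
          (Ioo_mem_nhdsLT (by linarith))
      have hR : ∀ᶠ x in 𝓝[>] c, F s x ≠ 0 ∧ x ∈ Ioo c (c + e) :=
        ((h.isolated s c).filter_mono (nhdsWithin_mono c fun x hx => ne_of_gt hx)).and
          (Ioo_mem_nhdsGT (by linarith))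
      obtain ⟨l, hl0, hl⟩ := hL.exists
      obtain ⟨r, hr0, hr⟩ := hR.exists
      have e1 : ∀ᶠ t in 𝓝[<] s, F t l ≠ 0 ∧ F t r ≠ 0 ∧ t ∈ Ico t₁ s :=
        (((h.continuous_time l).continuousAt.eventually_ne hl0).filter_mono
          nhdsWithin_le_nhds).and ((((h.continuous_time r).continuousAt.eventually_ne
            hr0).filter_mono nhdsWithin_le_nhds).and hI)
      obtain ⟨a, ha, Ha⟩ := (mem_nhdsLT_iff_exists_Ioo_subset' hs).1 e1
      have hfreq := (mapClusterPt_iff_frequently.1 hcl) (Ioo l r) (Ioo_mem_nhds hl.2 hr.1)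
      obtain ⟨τ, hτ, hτI⟩ := (hfreq.and_eventually (Ioo_mem_nhdsLT ha)).exists
      have hoc : OrdConnected (y '' Ioo a s) :=
        (isPreconnected_Ioo.image y
          (hy.continuousOn.mono fun t ht => (Ha ht).2.2)).ordConnected
      filter_upwards [Ioo_mem_nhdsLT ha] with t ht
      constructor
      · by_contra hcon
        obtain ⟨t', ht', he'⟩ := hoc.out (mem_image_of_mem y ht) (mem_image_of_mem y hτI)
          ⟨(not_lt.1 hcon).trans hl.1.le, hτ.1.le⟩
        exact (Ha ht').1 (he' ▸ hy.zero t' (Ha ht').2.2)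
      · by_contra hcon
        obtain ⟨t', ht', he'⟩ := hoc.out (mem_image_of_mem y hτI) (mem_image_of_mem y ht)
          ⟨hτ.2.le, hr.2.le.trans (not_lt.1 hcon)⟩
        exact (Ha ht').2.1 (he' ▸ hy.zero t' (Ha ht').2.2)
    refine ⟨fun a ha => (key (c - a) (by linarith)).mono fun t ht => by linarith [ht.1],
      fun a ha => (key (a - c) (by linarith)).mono fun t ht => by linarith [ht.2]⟩
  refine ⟨c, hc, ?_, hlim⟩
  have h1 : Tendsto (fun t => F t (y t)) (𝓝[<] s) (𝓝 (F s c)) :=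
    (h.continuous.tendsto (s, c)).comp ((tendsto_nhdsWithin_of_tendsto_nhds tendsto_id).prodMk_nhds
      hlim)
  refine tendsto_nhds_unique h1 (tendsto_const_nhds.congr' ?_)
  filter_upwards [hI] with t ht
  exact (hy.zero t ht).symm

/-- A regular zero can be followed forward in time, between two zero-free walls `α` and `β`, until
either the end of the time interval or a singular zero is reached. -/
theorem exists_branch_until_singular (h : RegularFamily F G) {t₁ b α β c : ℝ} (htb : t₁ ≤ b)
    (hα : ∀ t ∈ Icc t₁ b, F t α ≠ 0) (hβ : ∀ t ∈ Icc t₁ b, F t β ≠ 0) (hc : c ∈ Ioo α β)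
    (hF : F t₁ c = 0) (hG : G t₁ c ≠ 0) :
    ∃ s ∈ Icc t₁ b, ∃ y, y t₁ = c ∧ ZeroBranch F (Icc t₁ s) y ∧
      (∀ t ∈ Icc t₁ s, y t ∈ Ioo α β) ∧ (∀ t ∈ Ico t₁ s, G t (y t) ≠ 0) ∧
      (s = b ∨ G s (y s) = 0) := by
  -- `A` is the set of times up to which there is a regular branch; its supremum is the answer.
  let P : ℝ → (ℝ → ℝ) → Prop := fun t y => y t₁ = c ∧ ZeroBranch F (Icc t₁ t) y ∧
    ∀ τ ∈ Icc t₁ t, y τ ∈ Ioo α β ∧ G τ (y τ) ≠ 0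
  let A : Set ℝ := {t | t ∈ Icc t₁ b ∧ ∃ y, P t y}
  have hA₁ : t₁ ∈ A := by
    refine ⟨⟨le_rfl, htb⟩, fun _ => c, rfl, ⟨continuousOn_const, ?_⟩, ?_⟩
    · intro t ht; rw [Icc_self, mem_singleton_iff] at ht; rwa [ht]
    · intro t ht; rw [Icc_self, mem_singleton_iff] at ht; rw [ht]; exact ⟨hc, hG⟩
  have hbdd : BddAbove A := ⟨b, fun t ht => ht.1.2⟩
  set s := sSup A with hs_def
  have hs₁ : t₁ ≤ s := le_csSup hbdd hA₁
  have hsb : s ≤ b := csSup_le ⟨t₁, hA₁⟩ fun t ht => ht.1.2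
  by_cases hsA : s ∈ A
  · obtain ⟨_, y, hy1, hy2, hy3⟩ := hsA
    refine ⟨s, ⟨hs₁, hsb⟩, y, hy1, hy2, fun t ht => (hy3 t ht).1,
      fun t ht => (hy3 t (Ico_subset_Icc_self ht)).2, Or.inl ?_⟩
    by_contra hne
    have hlt : s < b := lt_of_le_of_ne hsb hne
    have hss : s ∈ Icc t₁ s := ⟨hs₁, le_rfl⟩
    obtain ⟨ε, hε, φ, hφ, hφs⟩ := h.exists_local_branch (hy2.zero s hss) (hy3 s hss).2
    have hφc : ContinuousAt φ s :=
      hφ.continuousOn.continuousAt (Icc_mem_nhds (by linarith) (by linarith))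
    have e1 : ∀ᶠ t in 𝓝 s, φ t ∈ Ioo α β ∧ G t (φ t) ≠ 0 ∧ t < b ∧ t < s + ε := by
      refine (hφc.eventually (Ioo_mem_nhds ?_ ?_)).and (.and ?_ ((gt_mem_nhds hlt).and
        (gt_mem_nhds (by linarith))))
      · rw [hφs]; exact (hy3 s hss).1.1
      · rw [hφs]; exact (hy3 s hss).1.2
      · refine ((h.continuous_deriv.continuousAt (x := (s, φ s))).comp
          (f := fun t => (t, φ t)) (continuousAt_id.prodMk hφc)).eventually_ne ?_
        simp only [Function.comp, hφs]
        exact (hy3 s hss).2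
    obtain ⟨δ, hδ, He⟩ := (nhds_basis_Icc_pos s).eventually_iff.1 e1
    have hend := He (show s + δ ∈ Icc (s - δ) (s + δ) from ⟨by linarith, le_rfl⟩)
    obtain ⟨w, hw, hw1, hw2⟩ := hy2.exists_glue hs₁ (by linarith : s ≤ s + δ)
      (hφ.mono (Icc_subset_Icc (by linarith) hend.2.2.2.le)) hφs.symm
    have : s + δ ∈ A := by
      refine ⟨⟨by linarith, hend.2.2.1.le⟩, w, by rw [hw1 ⟨le_rfl, hs₁⟩, hy1], hw, fun τ hτ => ?_⟩
      rcases le_total τ s with hτs | hτs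
      · rw [hw1 ⟨hτ.1, hτs⟩]; exact hy3 τ ⟨hτ.1, hτs⟩
      · rw [hw2 ⟨hτs, hτ.2⟩]
        have := He (show τ ∈ Icc (s - δ) (s + δ) from ⟨by linarith, hτ.2⟩)
        exact ⟨this.1, this.2.1⟩
    linarith [le_csSup hbdd this]
  · have hlt : t₁ < s := lt_of_le_of_ne hs₁ fun he => hsA (he ▸ hA₁)
    have hex : ∀ t, ∃ y, t ∈ Ico t₁ s → P t y := by
      intro t
      by_cases ht : t ∈ Ico t₁ s
      · obtain ⟨t', ⟨_, y, hy1, hy2, hy3⟩, htt'⟩ := exists_lt_of_lt_csSup ⟨t₁, hA₁⟩ ht.2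
        have hsub : Icc t₁ t ⊆ Icc t₁ t' := Icc_subset_Icc_right htt'.le
        exact ⟨y, fun _ => ⟨hy1, hy2.mono hsub, fun τ hτ => hy3 τ (hsub hτ)⟩⟩
      · exact ⟨0, fun h => absurd h ht⟩
    choose Y hY using hex
    -- By uniqueness, the branches over the intervals `[t₁, t]` with `t < s` fit together.
    have hYeq : ∀ t' ∈ Ico t₁ s, EqOn (fun t => Y t t) (Y t') (Icc t₁ t') := by
      intro t' ht' t ht
      have ht0 : t ∈ Ico t₁ s := ⟨ht.1, ht.2.trans_lt ht'.2⟩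
      refine h.eqOn_of_regular isPreconnected_Icc (hY t ht0).2.1
        ((hY t' ht').2.1.mono (Icc_subset_Icc_right ht.2)) (fun τ hτ => ((hY t ht0).2.2 τ hτ).2)
        (t₁ := t₁) ⟨le_rfl, ht.1⟩ ?_ ⟨ht.1, le_rfl⟩
      rw [(hY t ht0).1, (hY t' ht').1]
    have hP : ∀ t ∈ Ico t₁ s, Y t t ∈ Ioo α β ∧ G t (Y t t) ≠ 0 := fun t ht =>
      (hY t ht).2.2 t ⟨ht.1, le_rfl⟩
    have hbr : ZeroBranch F (Ico t₁ s) fun t => Y t t := by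
      refine ⟨fun t ht => ?_, fun t ht => (hY t ht).2.1.zero t ⟨ht.1, le_rfl⟩⟩
      obtain ⟨t', ht1, ht2⟩ := exists_between ht.2
      have ht' : t' ∈ Ico t₁ s := ⟨ht.1.trans ht1.le, ht2⟩
      have hc' : ContinuousWithinAt (fun t => Y t t) (Icc t₁ t') t :=
        ((hY t' ht').2.1.continuousOn.congr (hYeq t' ht')) t ⟨ht.1, ht1.le⟩
      refine hc'.mono_of_mem_nhdsWithin ?_
      filter_upwards [self_mem_nhdsWithin, mem_nhdsWithin_of_mem_nhds (gt_mem_nhds ht1)]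
        with τ hτ hτ' using ⟨hτ.1, le_of_lt hτ'⟩
    obtain ⟨d, hd, hd0, hlim⟩ := h.exists_tendsto_of_branch hlt hbr
      fun t ht => Ioo_subset_Icc_self (hP t ht).1
    have hdI : d ∈ Ioo α β := by
      refine ⟨lt_of_le_of_ne hd.1 fun he => hα s ⟨hs₁, hsb⟩ (by rw [he]; exact hd0),
        lt_of_le_of_ne hd.2 fun he => hβ s ⟨hs₁, hsb⟩ (by rw [← he]; exact hd0)⟩
    have hyt : ∀ t ∈ Ico t₁ s, Function.update (fun t => Y t t) s d t = Y t t := fun t ht =>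
      Function.update_of_ne ht.2.ne _ _
    have hbr' : ZeroBranch F (Icc t₁ s) (Function.update (fun t => Y t t) s d) := by
      refine ⟨continuousOn_update_iff.2 ⟨?_, fun _ => ?_⟩, fun t ht => ?_⟩
      · rw [Icc_sdiff_right]; exact hbr.continuousOn
      · rw [Icc_sdiff_right, nhdsWithin_Ico_eq_nhdsLT hlt]; exact hlim
      · rcases ht.2.eq_or_lt with rfl | hts
        · rw [Function.update_self]; exact hd0
        · rw [hyt t ⟨ht.1, hts⟩]; exact hbr.zero t ⟨ht.1, hts⟩
    have hmem : ∀ t ∈ Icc t₁ s, Function.update (fun t => Y t t) s d t ∈ Ioo α β := by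
      intro t ht
      rcases ht.2.eq_or_lt with rfl | hts
      · rw [Function.update_self]; exact hdI
      · rw [hyt t ⟨ht.1, hts⟩]; exact (hP t ⟨ht.1, hts⟩).1
    have hstart : Function.update (fun t => Y t t) s d t₁ = c := by
      rw [hyt t₁ ⟨le_rfl, hlt⟩]; exact (hY t₁ ⟨le_rfl, hlt⟩).1
    refine ⟨s, ⟨hs₁, hsb⟩, _, hstart, hbr', hmem, fun t ht => ?_, Or.inr ?_⟩
    · rw [hyt t ht]; exact (hP t ht).2
    · by_contra hne
      refine hsA ⟨⟨hs₁, hsb⟩, _, hstart, hbr', fun t ht => ⟨hmem t ht, ?_⟩⟩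
      rcases ht.2.eq_or_lt with rfl | hts
      · exact hne
      · rw [hyt t ⟨ht.1, hts⟩]; exact (hP t ⟨ht.1, hts⟩).2

/-- In a space-time box with zero-free walls and without singular zeros at interior times, there is
a branch over the whole closed time interval through every zero. -/
theorem exists_branch_through (h : RegularFamily F G) {a b t₁ α β c : ℝ} (ht₁ : t₁ ∈ Ioo a b)
    (hα : ∀ t ∈ Icc a b, F t α ≠ 0) (hβ : ∀ t ∈ Icc a b, F t β ≠ 0)
    (hreg : ∀ t ∈ Ioo a b, ∀ x ∈ Ioo α β, F t x = 0 → G t x ≠ 0) (hc : c ∈ Ioo α β)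
    (hF : F t₁ c = 0) :
    ∃ y, y t₁ = c ∧ ZeroBranch F (Icc a b) y ∧ ∀ t ∈ Icc a b, y t ∈ Ioo α β := by
  have hG := hreg t₁ ht₁ c hc hF
  have hfwd : ∃ y, y t₁ = c ∧ ZeroBranch F (Icc t₁ b) y ∧ ∀ t ∈ Icc t₁ b, y t ∈ Ioo α β := by
    obtain ⟨s, hs, y, hy1, hy2, hy3, -, hy4⟩ := h.exists_branch_until_singular ht₁.2.le
      (fun t ht => hα t ⟨ht₁.1.le.trans ht.1, ht.2⟩)
      (fun t ht => hβ t ⟨ht₁.1.le.trans ht.1, ht.2⟩) hc hF hG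
    have hss : s ∈ Icc t₁ s := ⟨hs.1, le_rfl⟩
    obtain rfl : s = b := by
      rcases hy4 with hy4 | hy4
      · exact hy4
      · by_contra hne
        exact hreg s ⟨ht₁.1.trans_le hs.1, lt_of_le_of_ne hs.2 hne⟩ _ (hy3 s hss)
          (hy2.zero s hss) hy4
    exact ⟨y, hy1, hy2, hy3⟩
  have hbwd : ∃ y, y t₁ = c ∧ ZeroBranch F (Icc a t₁) y ∧ ∀ t ∈ Icc a t₁, y t ∈ Ioo α β := by
    obtain ⟨s, hs, y, hy1, hy2, hy3, -, hy4⟩ := h.reverse.exists_branch_until_singular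
      (t₁ := -t₁) (b := -a) (neg_le_neg ht₁.1.le)
      (fun t ht => hα (-t) ⟨by linarith [ht.2], by linarith [ht.1, ht₁.2]⟩)
      (fun t ht => hβ (-t) ⟨by linarith [ht.2], by linarith [ht.1, ht₁.2]⟩) hc
      (by rw [neg_neg]; exact hF) (by rw [neg_neg]; exact hG)
    have hss : s ∈ Icc (-t₁) s := ⟨hs.1, le_rfl⟩
    obtain rfl : s = -a := by
      rcases hy4 with hy4 | hy4
      · exact hy4
      · by_contra hne
        exact hreg (-s) ⟨lt_neg_of_lt_neg (lt_of_le_of_ne hs.2 hne),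
          (neg_le.1 hs.1).trans_lt ht₁.2⟩ _ (hy3 s hss) (hy2.zero s hss) hy4
    have hm : ∀ t ∈ Icc a t₁, -t ∈ Icc (-t₁) (-a) := fun t ht =>
      ⟨neg_le_neg ht.2, neg_le_neg ht.1⟩
    refine ⟨fun t => y (-t), hy1, ⟨hy2.continuousOn.comp continuousOn_neg hm, fun t ht => ?_⟩,
      fun t ht => hy3 _ (hm t ht)⟩
    simpa using hy2.zero _ (hm t ht)
  obtain ⟨y, hy1, hy2, hy3⟩ := hfwd
  obtain ⟨z, hz1, hz2, hz3⟩ := hbwd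
  obtain ⟨w, hw, hwz, hwy⟩ := hz2.exists_glue ht₁.1.le ht₁.2.le hy2 (hz1.trans hy1.symm)
  refine ⟨w, by rw [hwy ⟨le_rfl, ht₁.2.le⟩, hy1], hw, fun t ht => ?_⟩
  rcases le_total t t₁ with hle | hle
  · rw [hwz ⟨ht.1, hle⟩]; exact hz3 t ⟨ht.1, hle⟩
  · rw [hwy ⟨hle, ht.2⟩]; exact hy3 t ⟨hle, ht.2⟩

/-- Implicit differentiation of a branch at a regular zero. -/
theorem hasDerivWithinAt_branch (h : RegularFamily F G) {I : Set ℝ} {y : ℝ → ℝ}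
    (hy : ZeroBranch F I y) {t Ft : ℝ} (ht : t ∈ I) (hG : G t (y t) ≠ 0)
    (hFt : HasDerivAt (fun τ => F τ (y t)) Ft t) :
    HasDerivWithinAt y (-Ft / G t (y t)) I t := by
  have hmvt : ∀ τ, ∃ ξ, |ξ - y t| ≤ |y τ - y t| ∧
      F τ (y τ) - F τ (y t) = G τ ξ * (y τ - y t) := by
    intro τ
    rcases lt_trichotomy (y t) (y τ) with hlt | heq | hgt
    · obtain ⟨ξ, hξ, he⟩ := exists_hasDerivAt_eq_slope (F τ) (G τ) hlt
        (h.continuous_space τ).continuousOn fun x _ => h.hasDerivAt τ x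
      refine ⟨ξ, ?_, by rw [he, div_mul_cancel₀ _ (sub_ne_zero.2 hlt.ne')]⟩
      rw [abs_of_pos (sub_pos.2 hξ.1), abs_of_pos (sub_pos.2 hlt)]
      linarith [hξ.2]
    · exact ⟨y t, by simp, by simp [heq]⟩
    · obtain ⟨ξ, hξ, he⟩ := exists_hasDerivAt_eq_slope (F τ) (G τ) hgt
        (h.continuous_space τ).continuousOn fun x _ => h.hasDerivAt τ x
      refine ⟨ξ, ?_, ?_⟩
      · rw [abs_of_neg (sub_neg.2 hξ.2), abs_of_neg (sub_neg.2 hgt)]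
        linarith [hξ.1]
      · have := sub_ne_zero.2 hgt.ne'
        rw [he]
        field_simp
        ring
  choose ξ hξ hξe using hmvt
  have hyt : Tendsto y (𝓝[I] t) (𝓝 (y t)) := hy.continuousOn t ht
  have hξt : Tendsto ξ (𝓝[I] t) (𝓝 (y t)) := by
    rw [tendsto_iff_norm_sub_tendsto_zero] at hyt ⊢
    exact squeeze_zero (fun _ => norm_nonneg _) hξ hyt
  have hGt : Tendsto (fun τ => G τ (ξ τ)) (𝓝[I] t) (𝓝 (G t (y t))) :=
    (h.continuous_deriv.tendsto (t, y t)).comp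
      ((tendsto_nhdsWithin_of_tendsto_nhds tendsto_id).prodMk_nhds hξt)
  rw [hasDerivWithinAt_iff_tendsto_slope]
  have hsub : 𝓝[I \ {t}] t ≤ 𝓝[I] t := nhdsWithin_mono _ sdiff_subset
  have hslope : Tendsto (slope (fun τ => F τ (y t)) t) (𝓝[I \ {t}] t) (𝓝 Ft) :=
    (hasDerivAt_iff_tendsto_slope.1 hFt).mono_left
      (nhdsWithin_mono _ fun τ hτ => hτ.2)
  refine (hslope.neg.div (hGt.mono_left hsub) hG).congr' ?_
  filter_upwards [self_mem_nhdsWithin, (hGt.mono_left hsub).eventually_ne hG] with τ hτ hτG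
  have hne : τ - t ≠ 0 := sub_ne_zero.2 hτ.2
  have he := hξe τ
  rw [hy.zero τ hτ.1] at he
  simp only [Pi.div_apply, slope_def_field, hy.zero t ht]
  field_simp
  linarith

end RegularFamily

/-! ### The heat flow near a zero: order, isolation and critical values -/

theorem heatPoly_zero (t : ℝ) : heatPoly 0 t = 0 := by
  simp [heatPoly]

theorem regularFamily_heatVal {q : ℝ[X]} (hq : q ≠ 0) :
    RegularFamily (heatVal q) (heatVal (derivative q)) where
  continuous := continuous_heatVal q
  continuous_deriv := continuous_heatVal _
  hasDerivAt := hasDerivAt_heatVal q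
  isolated t c := by
    have hfin : ((heatPoly q t).rootSet ℝ \ {c}).Finite :=
      ((heatPoly q t).rootSet_finite ℝ).subset sdiff_subset
    have hc : ((heatPoly q t).rootSet ℝ \ {c})ᶜ ∈ 𝓝 c :=
      hfin.isClosed.compl_mem_nhds fun h => h.2 rfl
    filter_upwards [mem_nhdsWithin_of_mem_nhds hc, self_mem_nhdsWithin] with x hx hxc h0
    refine hx ⟨(mem_rootSet).2 ⟨heatPoly_ne_zero hq t, ?_⟩, hxc⟩
    rw [aeval_def, Algebra.algebraMap_self, eval₂_id]
    exact h0

/-- Chain rule for the heat flow along a moving point. -/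
theorem hasDerivAt_heatVal_comp (q : ℝ[X]) {y : ℝ → ℝ} {y' t : ℝ} (hy : HasDerivAt y y' t) :
    HasDerivAt (fun τ => heatVal q τ (y τ))
      (heatVal (derivative (derivative q)) t (y t) / 2 + heatVal (derivative q) t (y t) * y') t := by
  have hN : q.natDegree < q.natDegree + 1 := Nat.lt_succ_self _
  have hN' : (derivative q).natDegree < q.natDegree + 1 :=
    lt_of_le_of_lt (natDegree_derivative_le q) (by lia)
  have ht : HasDerivAt (fun τ => heatVal q τ (y t)) (∑ j ∈ Finset.range (q.natDegree + 1),
      j * t ^ (j - 1) / (2 ^ j * j.factorial) * (derivative^[2 * j] q).eval (y t)) t := by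
    simp only [heatVal_eq_sum hN]
    exact HasDerivAt.fun_sum fun j _ => ((hasDerivAt_pow j t).div_const _).mul_const _
  have hu := ht.unique (hasDerivAt_heatVal_time q t (y t))
  have h : HasDerivAt (fun τ => heatVal q τ (y τ)) (∑ j ∈ Finset.range (q.natDegree + 1),
      (j * t ^ (j - 1) / (2 ^ j * j.factorial) * (derivative^[2 * j] q).eval (y t) +
        t ^ j / (2 ^ j * j.factorial) * ((derivative (derivative^[2 * j] q)).eval (y t) * y'))) t := by
    simp only [heatVal_eq_sum hN]
    exact HasDerivAt.fun_sum fun j _ => ((hasDerivAt_pow j t).div_const _).mul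
      (((derivative^[2 * j] q).hasDerivAt (y t)).comp t hy)
  refine h.congr_deriv ?_
  rw [Finset.sum_add_distrib, hu, heatVal_eq_sum hN', Finset.sum_mul]
  congr 1
  refine Finset.sum_congr rfl fun j _ => ?_
  rw [← Function.iterate_succ_apply, ← Function.iterate_succ_apply' derivative, mul_assoc]

/-- The polynomial `f` vanishes at `c` to order exactly `m`, with positive leading Taylor
coefficient. -/
def PositiveOfOrder (f : ℝ[X]) (c : ℝ) (m : ℕ) : Prop :=
  ∃ r : ℝ[X], f = (X - C c) ^ m * r ∧ 0 < r.eval c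

namespace PositiveOfOrder

variable {f : ℝ[X]} {c : ℝ} {m : ℕ}

theorem derivative (h : PositiveOfOrder f c (m + 1)) :
    PositiveOfOrder (Polynomial.derivative f) c m := by
  obtain ⟨r, rfl, hr⟩ := h
  refine ⟨(m + 1 : ℝ[X]) * r + (X - C c) * Polynomial.derivative r, ?_, ?_⟩
  · rw [derivative_mul, derivative_X_sub_C_pow]
    simp only [Nat.add_sub_cancel, Nat.cast_add, Nat.cast_one, C_add, C_1, map_natCast]
    ring
  · simp
    positivity

theorem eval_pos (h : PositiveOfOrder f c 0) : 0 < f.eval c := by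
  obtain ⟨r, rfl, hr⟩ := h
  simpa using hr

theorem eval_eq_zero (h : PositiveOfOrder f c (m + 1)) : f.eval c = 0 := by
  obtain ⟨r, rfl, hr⟩ := h
  simp

theorem ne_zero (h : PositiveOfOrder f c m) : f ≠ 0 := by
  obtain ⟨r, rfl, hr⟩ := h
  refine mul_ne_zero (pow_ne_zero _ (X_sub_C_ne_zero c)) fun h0 => ?_
  simp [h0] at hr

theorem eventually_mul_pow_pos (h : PositiveOfOrder f c m) :
    ∀ᶠ x in 𝓝[≠] c, 0 < f.eval x * (x - c) ^ m := by
  obtain ⟨r, rfl, hr⟩ := h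
  filter_upwards [mem_nhdsWithin_of_mem_nhds (r.continuous.continuousAt.eventually_const_lt hr),
    self_mem_nhdsWithin] with x hx hxc
  have h2 : 0 < ((x - c) ^ m) ^ 2 := by
    have := pow_ne_zero m (sub_ne_zero.2 hxc)
    positivity
  have : eval x ((X - C c) ^ m * r) * (x - c) ^ m = ((x - c) ^ m) ^ 2 * r.eval x := by
    simp; ring
  rw [this]
  exact mul_pos h2 hx

end PositiveOfOrder

theorem exists_positiveOfOrder {f : ℝ[X]} (hf : f ≠ 0) (c : ℝ) :
    ∃ m, PositiveOfOrder f c m ∨ PositiveOfOrder (-f) c m := by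
  obtain ⟨r, hr, hdvd⟩ := exists_eq_pow_rootMultiplicity_mul_and_not_dvd f hf c
  have hrc : r.eval c ≠ 0 := fun h => hdvd (dvd_iff_isRoot.2 h)
  refine ⟨f.rootMultiplicity c, ?_⟩
  rcases lt_or_gt_of_ne hrc with h | h
  · exact Or.inr ⟨-r, by rw [mul_neg, ← hr], by simpa using h⟩
  · exact Or.inl ⟨r, hr, h⟩

theorem eventually_forall_Icc_of_nhds_prod {s c : ℝ} {P : ℝ × ℝ → Prop}
    (hP : ∀ᶠ z in 𝓝 (s, c), P z) :
    ∀ᶠ δ in 𝓝[>] (0 : ℝ), ∀ᶠ t in 𝓝 s, ∀ x ∈ Icc (c - δ) (c + δ), P (t, x) := by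
  obtain ⟨η, hη, H⟩ := Metric.eventually_nhds_iff.1 hP
  filter_upwards [Ioo_mem_nhdsGT hη] with δ hδ
  filter_upwards [Metric.ball_mem_nhds s hη] with t ht x hx
  refine H ?_
  rw [Prod.dist_eq, max_lt_iff]
  refine ⟨ht, ?_⟩
  rw [Real.dist_eq, abs_lt]
  constructor <;> linarith [hx.1, hx.2, hδ.2]

theorem eventually_forall_Icc_of_punctured {c : ℝ} {Q : ℝ → Prop} (hQ : ∀ᶠ x in 𝓝[≠] c, Q x) :
    ∀ᶠ δ in 𝓝[>] (0 : ℝ), ∀ x ∈ Icc (c - δ) (c + δ), x ≠ c → Q x := by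
  obtain ⟨η, hη, H⟩ := Metric.eventually_nhds_iff.1 (eventually_nhdsWithin_iff.1 hQ)
  filter_upwards [Ioo_mem_nhdsGT hη] with δ hδ x hx hxc
  refine H ?_ hxc
  rw [Real.dist_eq, abs_lt]
  constructor <;> linarith [hx.1, hx.2, hδ.2]

theorem PositiveOfOrder.eventually_sides_even {f : ℝ[X]} {c : ℝ} {m : ℕ}
    (h : PositiveOfOrder f c m) (hm : Even m) :
    ∀ᶠ δ in 𝓝[>] (0 : ℝ), 0 < f.eval (c - δ) ∧ 0 < f.eval (c + δ) := by
  filter_upwards [eventually_forall_Icc_of_punctured h.eventually_mul_pow_pos,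
    self_mem_nhdsWithin] with δ H (hδ : 0 < δ)
  have h1 := H (c - δ) ⟨le_rfl, by linarith⟩ (by linarith)
  have h2 := H (c + δ) ⟨by linarith, le_rfl⟩ (by linarith)
  rw [show c - δ - c = -δ by ring, hm.neg_pow] at h1
  rw [add_sub_cancel_left] at h2
  have := pow_pos hδ m
  exact ⟨pos_of_mul_pos_left h1 this.le, pos_of_mul_pos_left h2 this.le⟩

theorem PositiveOfOrder.eventually_sides_odd {f : ℝ[X]} {c : ℝ} {m : ℕ}
    (h : PositiveOfOrder f c m) (hm : Odd m) :
    ∀ᶠ δ in 𝓝[>] (0 : ℝ), f.eval (c - δ) < 0 ∧ 0 < f.eval (c + δ) := by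
  filter_upwards [eventually_forall_Icc_of_punctured h.eventually_mul_pow_pos,
    self_mem_nhdsWithin] with δ H (hδ : 0 < δ)
  have h1 := H (c - δ) ⟨le_rfl, by linarith⟩ (by linarith)
  have h2 := H (c + δ) ⟨by linarith, le_rfl⟩ (by linarith)
  rw [show c - δ - c = -δ by ring, hm.neg_pow] at h1
  rw [add_sub_cancel_left] at h2
  have := pow_pos hδ m
  refine ⟨?_, pos_of_mul_pos_left h2 this.le⟩
  rw [mul_neg, ← neg_mul] at h1
  exact neg_pos.1 (pos_of_mul_pos_left h1 this.le)

/-- A box around `(s, c)` in which a given local property holds, whose walls carry no zeros and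
in which `c` is the only possible zero at time `s`. -/
theorem RegularFamily.exists_isolating_box {F G : ℝ → ℝ → ℝ} (h : RegularFamily F G) (s c : ℝ)
    {P : ℝ × ℝ → Prop} (hP : ∀ᶠ z in 𝓝 (s, c), P z) {δ₀ : ℝ} (hδ₀ : 0 < δ₀) :
    ∃ δ > 0, δ < δ₀ ∧ ∃ ε > 0, (∀ x ∈ Icc (c - δ) (c + δ), F s x = 0 → x = c) ∧
      ∀ t ∈ Icc (s - ε) (s + ε), F t (c - δ) ≠ 0 ∧ F t (c + δ) ≠ 0 ∧
        ∀ x ∈ Icc (c - δ) (c + δ), P (t, x) := by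
  obtain ⟨δ, ⟨hδ1, hδ2⟩, hδ : 0 < δ, hδδ⟩ := (((eventually_forall_Icc_of_nhds_prod hP).and
    (eventually_forall_Icc_of_punctured (h.isolated s c))).and (Ioo_mem_nhdsGT hδ₀)).exists
  have e1 := ((h.continuous_time (c - δ)).continuousAt (x := s)).eventually_ne
    (hδ2 (c - δ) ⟨le_rfl, by linarith⟩ (by linarith))
  have e2 := ((h.continuous_time (c + δ)).continuousAt (x := s)).eventually_ne
    (hδ2 (c + δ) ⟨by linarith, le_rfl⟩ (by linarith))
  obtain ⟨ε, hε, H⟩ := (nhds_basis_Icc_pos s).eventually_iff.1 (e1.and (e2.and hδ1))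
  exact ⟨δ, hδ, hδδ, ε, hε, fun x hx h0 => by_contra fun hne => hδ2 x hx hne h0, fun t ht => H ht⟩

/-- Forward in time, a zero of even order with positive leading coefficient is lifted off zero:
`u_t = u_xx / 2`, and `u_xx > 0` by induction on the order. -/
theorem eventually_heatVal_pos_of_even {q : ℝ[X]} {s c : ℝ} {m : ℕ}
    (h : PositiveOfOrder (heatPoly q s) c (2 * m)) :
    ∀ᶠ z in 𝓝 (s, c), s < z.1 → 0 < heatVal q z.1 z.2 := by
  induction m generalizing q with
  | zero =>
    have hpos : 0 < heatVal q s c := h.eval_pos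
    exact (((continuous_heatVal q).continuousAt (x := (s, c))).eventually_const_lt hpos).mono
      fun _ hz _ => hz
  | succ m ih =>
    have h2 : PositiveOfOrder (heatPoly (derivative (derivative q)) s) c (2 * m) := by
      rw [heatPoly_derivative, heatPoly_derivative]
      exact PositiveOfOrder.derivative (PositiveOfOrder.derivative h)
    obtain ⟨η, hη, H⟩ := Metric.eventually_nhds_iff.1 (ih h2)
    have h0 : ∀ᶠ x in 𝓝 c, 0 ≤ heatVal q s x := by
      have := eventually_nhdsWithin_iff.1 h.eventually_mul_pow_pos
      filter_upwards [this] with x hx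
      by_cases hxc : x = c
      · rw [hxc]
        exact (PositiveOfOrder.eval_eq_zero (m := 2 * m + 1) h).ge
      · exact (pos_of_mul_pos_left (hx hxc) (Even.pow_nonneg (even_two_mul _) _)).le
    have h0' : ∀ᶠ z : ℝ × ℝ in 𝓝 (s, c), 0 ≤ heatVal q s z.2 :=
      (continuous_snd.tendsto (s, c)).eventually h0
    filter_upwards [h0', Metric.ball_mem_nhds (s, c) hη] with z hz hzη hsz
    rw [Metric.mem_ball, Prod.dist_eq, max_lt_iff, Real.dist_eq, Real.dist_eq] at hzη
    have hmono : StrictMonoOn (fun τ => heatVal q τ z.2) (Icc s z.1) := by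
      refine strictMonoOn_of_deriv_pos (convex_Icc _ _)
        (fun τ _ => (hasDerivAt_heatVal_time q τ z.2).continuousAt.continuousWithinAt)
        fun τ hτ => ?_
      rw [interior_Icc] at hτ
      rw [(hasDerivAt_heatVal_time q τ z.2).deriv]
      refine half_pos (H (y := (τ, z.2)) ?_ hτ.1)
      rw [Prod.dist_eq, max_lt_iff, Real.dist_eq, Real.dist_eq]
      refine ⟨lt_of_le_of_lt ?_ hzη.1, hzη.2⟩
      rw [abs_of_pos (sub_pos.2 hτ.1), abs_of_pos (sub_pos.2 hsz)]
      linarith [hτ.2]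
    exact hz.trans_lt (hmono ⟨le_rfl, hsz.le⟩ ⟨hsz.le, le_rfl⟩ hsz)

/-- There are no singular zeros shortly after time `s`. -/
theorem eventually_not_singular_right {q : ℝ[X]} (hq : q ≠ 0) (s c : ℝ) :
    ∀ᶠ z in 𝓝 (s, c), s < z.1 →
      ¬ (heatVal q z.1 z.2 = 0 ∧ heatVal (derivative q) z.1 z.2 = 0) := by
  have key : ∀ {q : ℝ[X]} {m : ℕ}, PositiveOfOrder (heatPoly q s) c m →
      ∀ᶠ z in 𝓝 (s, c), s < z.1 →
        ¬ (heatVal q z.1 z.2 = 0 ∧ heatVal (derivative q) z.1 z.2 = 0) := by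
    intro q m h
    rcases Nat.even_or_odd' m with ⟨k, rfl | rfl⟩
    · filter_upwards [eventually_heatVal_pos_of_even h] with z hz hs h0
      exact (hz hs).ne' h0.1
    · have h1 : PositiveOfOrder (heatPoly (derivative q) s) c (2 * k) := by
        rw [heatPoly_derivative]
        exact PositiveOfOrder.derivative h
      filter_upwards [eventually_heatVal_pos_of_even h1] with z hz hs h0
      exact (hz hs).ne' h0.2
  obtain ⟨m, hm | hm⟩ := exists_positiveOfOrder (heatPoly_ne_zero hq s) c
  · exact key hm
  · rw [← heatPoly_neg] at hm
    filter_upwards [key hm] with z hz hs h0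
    refine hz hs ?_
    rw [derivative_neg, heatVal_neg, heatVal_neg, h0.1, h0.2, neg_zero]
    exact ⟨rfl, rfl⟩

theorem pos_of_continuousOn_Ico {f : ℝ → ℝ} {a b : ℝ} (hf : ContinuousOn f (Ico a b))
    (hne : ∀ t ∈ Ico a b, f t ≠ 0) (ha : 0 < f a) : ∀ t ∈ Ico a b, 0 < f t := by
  intro t ht
  by_contra hcon
  obtain ⟨t', ht', h0⟩ := isPreconnected_Ico.intermediate_value ht
    (show a ∈ Ico a b from ⟨le_rfl, ht.1.trans_lt ht.2⟩) hf ⟨not_lt.1 hcon, ha.le⟩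
  exact hne t' ht' h0

/-- Shortly before a zero `(s, c)`, the function and its second derivative have opposite signs at
nearby critical points: following a critical point forward in time to `(s, c)`, the critical value
moves with velocity `u_xx / 2` and ends at zero. -/
theorem eventually_critical_value_of_regular_derivative {q : ℝ[X]} {s c : ℝ}
    (hq : derivative q ≠ 0) (h0 : heatVal q s c = 0)
    (hD : ∀ᶠ z in 𝓝 (s, c), z.1 < s →
      ¬ (heatVal (derivative q) z.1 z.2 = 0 ∧
        heatVal (derivative (derivative q)) z.1 z.2 = 0)) :
    ∀ᶠ z in 𝓝 (s, c), z.1 < s → heatVal (derivative q) z.1 z.2 = 0 →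
      heatVal q z.1 z.2 * heatVal (derivative (derivative q)) z.1 z.2 < 0 := by
  have hR := regularFamily_heatVal hq
  obtain ⟨δ, hδ, -, ε, hε, hiso, hbox⟩ := hR.exists_isolating_box s c hD one_pos
  filter_upwards [prod_mem_nhds (Ioo_mem_nhds (by linarith : s - ε < s) (by linarith : s < s + ε))
    (Ioo_mem_nhds (by linarith : c - δ < c) (by linarith : c < c + δ))]
  rintro ⟨t, x⟩ ⟨ht, hx⟩ (hts : t < s) (hcrit : heatVal (derivative q) t x = 0)
  change t ∈ Ioo (s - ε) (s + ε) at ht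
  change x ∈ Ioo (c - δ) (c + δ) at hx
  have hsub : ∀ τ ∈ Icc (s - ε) s, τ ∈ Icc (s - ε) (s + ε) := fun τ hτ =>
    ⟨hτ.1, by linarith [hτ.2]⟩
  have hreg : ∀ τ ∈ Ioo (s - ε) s, ∀ x ∈ Ioo (c - δ) (c + δ), heatVal (derivative q) τ x = 0 →
      heatVal (derivative (derivative q)) τ x ≠ 0 := fun τ hτ x hx h1 h2 =>
    (hbox τ (hsub τ (Ioo_subset_Icc_self hτ))).2.2 x (Ioo_subset_Icc_self hx) hτ.2 ⟨h1, h2⟩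
  obtain ⟨y, hyt, hy, hyI⟩ := hR.exists_branch_through (a := s - ε) (b := s) ⟨ht.1, hts⟩
    (fun τ hτ => (hbox τ (hsub τ hτ)).1) (fun τ hτ => (hbox τ (hsub τ hτ)).2.1) hreg hx hcrit
  have hs : s ∈ Icc (s - ε) s := ⟨by linarith, le_rfl⟩
  have hys : y s = c := hiso _ (Ioo_subset_Icc_self (hyI s hs)) (hy.zero s hs)
  have hne : ∀ τ ∈ Ioo (s - ε) s, heatVal (derivative (derivative q)) τ (y τ) ≠ 0 := fun τ hτ =>
    hreg τ hτ _ (hyI τ (Ioo_subset_Icc_self hτ)) (hy.zero τ (Ioo_subset_Icc_self hτ))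
  have hcont : ∀ r : ℝ[X], ContinuousOn (fun τ => heatVal r τ (y τ)) (Icc t s) := fun r =>
    (continuous_heatVal r).comp_continuousOn
      (continuousOn_id.prodMk (hy.continuousOn.mono (Icc_subset_Icc_left ht.1.le)))
  have hderiv : ∀ τ ∈ Ioo t s, HasDerivAt (fun τ => heatVal q τ (y τ))
      (heatVal (derivative (derivative q)) τ (y τ) / 2) τ := by
    intro τ hτ
    have hτ' : τ ∈ Ioo (s - ε) s := ⟨ht.1.trans hτ.1, hτ.2⟩
    have hy' := (hR.hasDerivWithinAt_branch hy (Ioo_subset_Icc_self hτ') (hne τ hτ')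
      (hasDerivAt_heatVal_time _ τ (y τ))).hasDerivAt (Icc_mem_nhds hτ'.1 hτ'.2)
    refine (hasDerivAt_heatVal_comp q hy').congr_deriv ?_
    rw [hy.zero τ (Ioo_subset_Icc_self hτ'), zero_mul, add_zero]
  have hcont2 : ContinuousOn (fun τ => heatVal (derivative (derivative q)) τ (y τ)) (Ico t s) :=
    (hcont _).mono Ico_subset_Icc_self
  have hne2 : ∀ τ ∈ Ico t s, heatVal (derivative (derivative q)) τ (y τ) ≠ 0 := fun τ hτ =>
    hne τ ⟨ht.1.trans_le hτ.1, hτ.2⟩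
  have hend : heatVal q s (y s) = 0 := by rw [hys, h0]
  show heatVal q t x * heatVal (derivative (derivative q)) t x < 0
  rw [← hyt]
  rcases lt_or_gt_of_ne (hne2 t ⟨le_rfl, hts⟩) with hlt | hgt
  · have hneg : ∀ τ ∈ Ico t s, 0 < -heatVal (derivative (derivative q)) τ (y τ) :=
      pos_of_continuousOn_Ico hcont2.neg (fun τ hτ => neg_ne_zero.2 (hne2 τ hτ)) (neg_pos.2 hlt)
    have hanti : StrictAntiOn (fun τ => heatVal q τ (y τ)) (Icc t s) := by
      refine strictAntiOn_of_deriv_neg (convex_Icc _ _) (hcont q) fun τ hτ => ?_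
      rw [interior_Icc] at hτ
      rw [(hderiv τ hτ).deriv]
      linarith [hneg τ ⟨hτ.1.le, hτ.2⟩]
    have := hanti ⟨le_rfl, hts.le⟩ ⟨hts.le, le_rfl⟩ hts
    exact mul_neg_of_pos_of_neg (by simpa only [hend] using this) hlt
  · have hpos := pos_of_continuousOn_Ico hcont2 hne2 hgt
    have hmono : StrictMonoOn (fun τ => heatVal q τ (y τ)) (Icc t s) := by
      refine strictMonoOn_of_deriv_pos (convex_Icc _ _) (hcont q) fun τ hτ => ?_
      rw [interior_Icc] at hτ
      rw [(hderiv τ hτ).deriv]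
      linarith [hpos τ ⟨hτ.1.le, hτ.2⟩]
    have := hmono ⟨le_rfl, hts.le⟩ ⟨hts.le, le_rfl⟩ hts
    exact mul_neg_of_neg_of_pos (by simpa only [hend] using this) hgt

/-- There are no singular zeros shortly before time `s`; by induction on the order of the zero
at `(s, c)`. -/
theorem eventually_not_singular_left {q : ℝ[X]} (hq : q ≠ 0) (s c : ℝ) :
    ∀ᶠ z in 𝓝 (s, c), z.1 < s →
      ¬ (heatVal q z.1 z.2 = 0 ∧ heatVal (derivative q) z.1 z.2 = 0) := by
  obtain ⟨m, hm⟩ := exists_positiveOfOrder (heatPoly_ne_zero hq s) c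
  clear hq
  induction m generalizing q with
  | zero =>
    have hne : heatVal q s c ≠ 0 := by
      rcases hm with hm | hm
      · exact hm.eval_pos.ne'
      · have := hm.eval_pos
        rw [eval_neg, neg_pos] at this
        exact this.ne
    exact (((continuous_heatVal q).continuousAt (x := (s, c))).eventually_ne hne).mono
      fun z hz _ h0 => hz h0.1
  | succ m ih =>
    have h0 : heatVal q s c = 0 := by
      rcases hm with hm | hm
      · exact hm.eval_eq_zero
      · have := hm.eval_eq_zero
        rwa [eval_neg, neg_eq_zero] at this
    have hm' : PositiveOfOrder (heatPoly (derivative q) s) c m ∨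
        PositiveOfOrder (-heatPoly (derivative q) s) c m := by
      rw [heatPoly_derivative, ← derivative_neg]
      exact hm.imp PositiveOfOrder.derivative PositiveOfOrder.derivative
    have hq' : derivative q ≠ 0 := by
      intro h
      rw [h, heatPoly_zero, neg_zero, or_self] at hm'
      exact hm'.ne_zero rfl
    filter_upwards [eventually_critical_value_of_regular_derivative hq' h0 (ih hm')]
      with z hz hs hcon
    have := hz hs hcon.2
    rw [hcon.1, zero_mul] at this
    exact lt_irrefl _ this

theorem eventually_critical_value {q : ℝ[X]} (hq : derivative q ≠ 0) {s c : ℝ}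
    (h0 : heatVal q s c = 0) :
    ∀ᶠ z in 𝓝 (s, c), z.1 < s → heatVal (derivative q) z.1 z.2 = 0 →
      heatVal q z.1 z.2 * heatVal (derivative (derivative q)) z.1 z.2 < 0 :=
  eventually_critical_value_of_regular_derivative hq h0 (eventually_not_singular_left hq s c)

/-! ### Zeros just before a given zero -/

/-- The last crossing of zero, from negative to positive values, is an upward crossing. -/
theorem exists_zero_deriv_nonneg {f f' : ℝ → ℝ} {a b : ℝ} (hab : a < b)
    (hf : ∀ x, HasDerivAt f (f' x) x) (ha : f a < 0) (hb : 0 < f b) :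
    ∃ c ∈ Ioo a b, f c = 0 ∧ 0 ≤ f' c := by
  have hcont : Continuous f := continuous_iff_continuousAt.2 fun x => (hf x).continuousAt
  have hK : IsCompact (Icc a b ∩ {x | f x ≤ 0}) :=
    isCompact_Icc.inter_right (isClosed_le hcont continuous_const)
  obtain ⟨c, ⟨hc, hcf⟩, hmax⟩ := hK.exists_isGreatest ⟨a, ⟨le_rfl, hab.le⟩, ha.le⟩
  have hcb : c < b := lt_of_le_of_ne hc.2 fun h => (lt_irrefl (0 : ℝ)) (hb.trans_le (h ▸ hcf))
  have hright : ∀ᶠ x in 𝓝[>] c, 0 < f x := by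
    filter_upwards [Ioo_mem_nhdsGT hcb] with x hx
    by_contra hcon
    exact hx.1.not_ge (hmax ⟨⟨hc.1.trans hx.1.le, hx.2.le⟩, not_lt.1 hcon⟩)
  have h0 : f c = 0 := le_antisymm hcf (ge_of_tendsto
    (hcont.continuousAt.tendsto.mono_left nhdsWithin_le_nhds) (hright.mono fun _ h => h.le))
  have hac : a < c := lt_of_le_of_ne hc.1 fun h => by rw [h, h0] at ha; exact lt_irrefl _ ha
  refine ⟨c, ⟨hac, hcb⟩, h0, ?_⟩
  have hs : Tendsto (slope f c) (𝓝[>] c) (𝓝 (f' c)) :=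
    (hasDerivAt_iff_tendsto_slope.1 (hf c)).mono_left (nhdsWithin_mono _ fun x hx => ne_of_gt hx)
  refine ge_of_tendsto hs ?_
  filter_upwards [hright, self_mem_nhdsWithin] with x hx (hxc : c < x)
  rw [slope_def_field, h0, sub_zero]
  exact div_nonneg hx.le (sub_pos.2 hxc).le

theorem exists_zero_right_of_deriv_pos {f : ℝ → ℝ} {f' z b : ℝ} (hf : Continuous f)
    (hz : f z = 0) (hd : HasDerivAt f f' z) (hpos : 0 < f') (hzb : z < b) (hb : f b < 0) :
    ∃ x ∈ Ioo z b, f x = 0 := by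
  have hs : Tendsto (slope f z) (𝓝[>] z) (𝓝 f') :=
    (hasDerivAt_iff_tendsto_slope.1 hd).mono_left (nhdsWithin_mono _ fun x hx => ne_of_gt hx)
  obtain ⟨x, hx1, hx2⟩ := ((hs.eventually_const_lt hpos).and (Ioo_mem_nhdsGT hzb)).exists
  rw [slope_def_field, hz, sub_zero] at hx1
  have hfx : 0 < f x := (div_pos_iff_of_pos_right (sub_pos.2 hx2.1)).1 hx1
  obtain ⟨y, hy, h0⟩ := intermediate_value_Ioo' hx2.2.le hf.continuousOn ⟨hb, hfx⟩
  exact ⟨y, ⟨hx2.1.trans hy.1, hy.2⟩, h0⟩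

theorem exists_zero_left_of_deriv_pos {f : ℝ → ℝ} {f' z a : ℝ} (hf : Continuous f)
    (hz : f z = 0) (hd : HasDerivAt f f' z) (hpos : 0 < f') (haz : a < z) (ha : 0 < f a) :
    ∃ x ∈ Ioo a z, f x = 0 := by
  have hd' : HasDerivAt (fun x => -f (-x)) f' (-z) := by
    have h1 : HasDerivAt f f' (- -z) := by rwa [neg_neg]
    exact (h1.comp (-z) (hasDerivAt_neg (-z))).neg.congr_deriv (by ring)
  obtain ⟨x, hx, h0⟩ := exists_zero_right_of_deriv_pos (f := fun x => -f (-x)) (z := -z) (b := -a)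
    (hf.comp continuous_neg).neg (by simpa using hz) hd' hpos (neg_lt_neg haz) (by simpa using ha)
  exact ⟨-x, ⟨by linarith [hx.2], by linarith [hx.1]⟩, neg_eq_zero.1 h0⟩

theorem continuous_heatVal_space (q : ℝ[X]) (t : ℝ) : Continuous (heatVal q t) :=
  (heatPoly q t).continuous

theorem continuous_heatVal_time (q : ℝ[X]) (x : ℝ) : Continuous fun t => heatVal q t x :=
  (continuous_heatVal q).comp (continuous_id.prodMk continuous_const)

/-- Just before a zero of even order `≥ 2` with positive leading coefficient, the function takes
negative values nearby. -/
theorem eventually_exists_heatVal_neg {q : ℝ[X]} {s c : ℝ} {k : ℕ}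
    (h : PositiveOfOrder (heatPoly q s) c (2 * k + 2)) {δ₀ : ℝ} (hδ₀ : 0 < δ₀) :
    ∀ᶠ t in 𝓝[<] s, ∃ x ∈ Ioo (c - δ₀) (c + δ₀), heatVal q t x < 0 := by
  have h1 : PositiveOfOrder (heatPoly (derivative q) s) c (2 * k + 1) := by
    rw [heatPoly_derivative]
    exact PositiveOfOrder.derivative h
  have hq' : derivative q ≠ 0 := fun h0 => h1.ne_zero (by rw [h0, heatPoly_zero])
  have h0 : heatVal q s c = 0 := h.eval_eq_zero
  obtain ⟨δ, ⟨⟨hδ1, hδ2, hδ3⟩, hδ : 0 < δ, hδδ⟩⟩ := (((eventually_forall_Icc_of_nhds_prod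
    (eventually_critical_value hq' h0)).and (h1.eventually_sides_odd ⟨k, rfl⟩)).and
    (Ioo_mem_nhdsGT hδ₀)).exists
  filter_upwards [self_mem_nhdsWithin, mem_nhdsWithin_of_mem_nhds hδ1, mem_nhdsWithin_of_mem_nhds
    ((continuous_heatVal_time (derivative q) (c - δ)).continuousAt.eventually_lt_const hδ2),
    mem_nhdsWithin_of_mem_nhds ((continuous_heatVal_time (derivative q)
      (c + δ)).continuousAt.eventually_const_lt hδ3)] with t (hts : t < s) ht hl hr
  obtain ⟨x, hx, hx0, hx2⟩ := exists_zero_deriv_nonneg (by linarith : c - δ < c + δ)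
    (hasDerivAt_heatVal (derivative q) t) hl hr
  refine ⟨x, ⟨by linarith [hx.1], by linarith [hx.2]⟩, ?_⟩
  have := ht x (Ioo_subset_Icc_self hx) hts hx0
  by_contra hcon
  exact this.not_ge (mul_nonneg (not_lt.1 hcon) hx2)

/-- Every zero is a limit of zeros at earlier times. -/
theorem eventually_exists_zero_left {q : ℝ[X]} (hq : q ≠ 0) {s c : ℝ} (h0 : heatVal q s c = 0)
    {δ₀ : ℝ} (hδ₀ : 0 < δ₀) :
    ∀ᶠ t in 𝓝[<] s, ∃ x ∈ Ioo (c - δ₀) (c + δ₀), heatVal q t x = 0 := by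
  have key : ∀ {q : ℝ[X]} {m : ℕ}, heatVal q s c = 0 → PositiveOfOrder (heatPoly q s) c m →
      ∀ᶠ t in 𝓝[<] s, ∃ x ∈ Ioo (c - δ₀) (c + δ₀), heatVal q t x = 0 := by
    intro q m h0 h
    rcases Nat.even_or_odd' m with ⟨k, rfl | rfl⟩
    · obtain _ | k := k
      · exact absurd h0 h.eval_pos.ne'
      obtain ⟨δ, ⟨hδ1, hδ2⟩, hδ : 0 < δ, hδδ⟩ := ((h.eventually_sides_even (even_two_mul _)).and
        (Ioo_mem_nhdsGT hδ₀)).exists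
      filter_upwards [eventually_exists_heatVal_neg h hδ, mem_nhdsWithin_of_mem_nhds
        ((continuous_heatVal_time q (c + δ)).continuousAt.eventually_const_lt hδ2)]
        with t ⟨x, hx, hneg⟩ hr
      obtain ⟨y, hy, hy0⟩ := intermediate_value_Ioo hx.2.le
        (continuous_heatVal_space q t).continuousOn ⟨hneg, hr⟩
      exact ⟨y, ⟨by linarith [hx.1, hy.1], by linarith [hy.2]⟩, hy0⟩
    · obtain ⟨δ, ⟨hδ1, hδ2⟩, hδ : 0 < δ, hδδ⟩ := ((h.eventually_sides_odd ⟨k, rfl⟩).and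
        (Ioo_mem_nhdsGT hδ₀)).exists
      filter_upwards [mem_nhdsWithin_of_mem_nhds
        ((continuous_heatVal_time q (c - δ)).continuousAt.eventually_lt_const hδ1),
        mem_nhdsWithin_of_mem_nhds
        ((continuous_heatVal_time q (c + δ)).continuousAt.eventually_const_lt hδ2)] with t hl hr
      obtain ⟨y, hy, hy0⟩ := intermediate_value_Ioo (by linarith : c - δ ≤ c + δ)
        (continuous_heatVal_space q t).continuousOn ⟨hl, hr⟩
      exact ⟨y, ⟨by linarith [hy.1], by linarith [hy.2]⟩, hy0⟩
  obtain ⟨m, hm | hm⟩ := exists_positiveOfOrder (heatPoly_ne_zero hq s) c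
  · exact key h0 hm
  · rw [← heatPoly_neg] at hm
    refine (key (by rw [heatVal_neg, h0, neg_zero]) hm).mono fun t => ?_
    rintro ⟨x, hx, hx0⟩
    exact ⟨x, hx, by rwa [heatVal_neg, neg_eq_zero] at hx0⟩

/-- Just before a singular zero `(s, c)`, an increasing zero near `c` is not the only zero
near `c`. -/
theorem eventually_exists_other_zero {q : ℝ[X]} (hq : q ≠ 0) {s c : ℝ} (h0 : heatVal q s c = 0)
    (h1 : heatVal (derivative q) s c = 0) {δ₀ : ℝ} (hδ₀ : 0 < δ₀) :
    ∀ᶠ w in 𝓝 (s, c), w.1 < s → heatVal q w.1 w.2 = 0 → 0 < heatVal (derivative q) w.1 w.2 →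
      ∃ x ∈ Ioo (c - δ₀) (c + δ₀), x ≠ w.2 ∧ heatVal q w.1 x = 0 := by
  -- If a wall value of `u` has the sign opposite to the one next to the increasing zero, the
  -- intermediate value theorem applies.
  have wallL : (∀ᶠ δ in 𝓝[>] (0 : ℝ), 0 < heatVal q s (c - δ)) → ∀ᶠ w in 𝓝 (s, c), w.1 < s →
      heatVal q w.1 w.2 = 0 → 0 < heatVal (derivative q) w.1 w.2 →
      ∃ x ∈ Ioo (c - δ₀) (c + δ₀), x ≠ w.2 ∧ heatVal q w.1 x = 0 := by
    intro hwall
    obtain ⟨δ, hδ1, hδ : 0 < δ, hδδ⟩ := (hwall.and (Ioo_mem_nhdsGT hδ₀)).exists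
    filter_upwards [prod_mem_nhds ((continuous_heatVal_time q
      (c - δ)).continuousAt.eventually_const_lt hδ1)
      (Ioo_mem_nhds (by linarith : c - δ < c) (by linarith : c < c + δ))]
    rintro ⟨t, z⟩ ⟨ht, hz⟩ _ hz0 hz1
    obtain ⟨x, hx, hx0⟩ := exists_zero_left_of_deriv_pos (continuous_heatVal_space q t) hz0
      (hasDerivAt_heatVal q t z) hz1 hz.1 ht
    exact ⟨x, ⟨by linarith [hx.1], by linarith [hx.2, hz.2]⟩, hx.2.ne, hx0⟩
  have wallR : (∀ᶠ δ in 𝓝[>] (0 : ℝ), heatVal q s (c + δ) < 0) → ∀ᶠ w in 𝓝 (s, c), w.1 < s →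
      heatVal q w.1 w.2 = 0 → 0 < heatVal (derivative q) w.1 w.2 →
      ∃ x ∈ Ioo (c - δ₀) (c + δ₀), x ≠ w.2 ∧ heatVal q w.1 x = 0 := by
    intro hwall
    obtain ⟨δ, hδ1, hδ : 0 < δ, hδδ⟩ := (hwall.and (Ioo_mem_nhdsGT hδ₀)).exists
    filter_upwards [prod_mem_nhds ((continuous_heatVal_time q
      (c + δ)).continuousAt.eventually_lt_const hδ1)
      (Ioo_mem_nhds (by linarith : c - δ < c) (by linarith : c < c + δ))]
    rintro ⟨t, z⟩ ⟨ht, hz⟩ _ hz0 hz1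
    obtain ⟨x, hx, hx0⟩ := exists_zero_right_of_deriv_pos (continuous_heatVal_space q t) hz0
      (hasDerivAt_heatVal q t z) hz1 hz.2 ht
    exact ⟨x, ⟨by linarith [hx.1, hz.1], by linarith [hx.2]⟩, hx.1.ne', hx0⟩
  have hneg : ∀ x, heatVal q s x = -(-heatPoly q s).eval x := fun x => by simp [heatVal]
  obtain ⟨m, hm | hm⟩ := exists_positiveOfOrder (heatPoly_ne_zero hq s) c
  · rcases Nat.even_or_odd' m with ⟨k, rfl | rfl⟩
    · exact wallL ((hm.eventually_sides_even (even_two_mul _)).mono fun _ h => h.1)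
    · have hm1 : PositiveOfOrder (heatPoly (derivative q) s) c (2 * k) := by
        rw [heatPoly_derivative]
        exact PositiveOfOrder.derivative hm
      obtain _ | k := k
      · exact absurd h1 hm1.eval_pos.ne'
      have hq' : derivative q ≠ 0 := fun h0 => hm1.ne_zero (by rw [h0, heatPoly_zero])
      obtain ⟨δ, ⟨⟨hδ1, hδ2, hδ3⟩, hδ : 0 < δ, hδδ⟩⟩ := (((eventually_forall_Icc_of_nhds_prod
        (eventually_critical_value hq' h0)).and (hm1.eventually_sides_even (even_two_mul _))).and
        (Ioo_mem_nhdsGT hδ₀)).exists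
      have hE := eventually_nhdsWithin_iff.1 (eventually_exists_heatVal_neg hm1 hδ)
      filter_upwards [prod_mem_nhds (inter_mem hE (inter_mem hδ1 (inter_mem
        ((continuous_heatVal_time (derivative q) (c - δ)).continuousAt.eventually_const_lt hδ2)
        ((continuous_heatVal_time (derivative q) (c + δ)).continuousAt.eventually_const_lt hδ3))))
        (Ioo_mem_nhds (by linarith : c - δ < c) (by linarith : c < c + δ))]
      rintro ⟨t, z⟩ ⟨⟨hE, hT, hl, hr⟩, hz⟩ hts hz0 hz1
      change 0 < heatVal (derivative q) t (c - δ) at hl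
      change 0 < heatVal (derivative q) t (c + δ) at hr
      change t < s at hts
      change heatVal q t z = 0 at hz0
      change 0 < heatVal (derivative q) t z at hz1
      change z ∈ Ioo (c - δ) (c + δ) at hz
      -- `u_x < 0` somewhere, so `u_x` changes sign beyond the increasing zero; the critical value
      -- there has the sign that forces another zero in between.
      obtain ⟨w, hw, hw1⟩ := hE hts
      rcases lt_trichotomy z w with hzw | rfl | hwz
      · obtain ⟨y, hy, hy0, hy2⟩ := exists_zero_deriv_nonneg hw.2
          (hasDerivAt_heatVal (derivative q) t) hw1 hr
        have hyT := hT y ⟨by linarith [hw.1, hy.1], hy.2.le⟩ hts hy0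
        have hyneg : heatVal q t y < 0 := by
          by_contra hcon
          exact hyT.not_ge (mul_nonneg (not_lt.1 hcon) hy2)
        obtain ⟨x, hx, hx0⟩ := exists_zero_right_of_deriv_pos (continuous_heatVal_space q t) hz0
          (hasDerivAt_heatVal q t z) hz1 (hzw.trans hy.1) hyneg
        exact ⟨x, ⟨by linarith [hx.1, hz.1], by linarith [hx.2, hy.2]⟩, hx.1.ne', hx0⟩
      · exact absurd hz1 hw1.not_gt
      · obtain ⟨y, hy, hy0, hy2⟩ := exists_zero_deriv_nonneg hw.1
          (fun x => (hasDerivAt_heatVal (derivative q) t x).fun_neg) (neg_lt_zero.2 hl)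
          (neg_pos.2 hw1)
        rw [neg_eq_zero] at hy0
        have hyT := hT y ⟨hy.1.le, by linarith [hw.2, hy.2]⟩ hts hy0
        have hypos : 0 < heatVal q t y := by
          by_contra hcon
          exact hyT.not_ge (mul_nonneg_of_nonpos_of_nonpos (not_lt.1 hcon) (neg_nonneg.1 hy2))
        obtain ⟨x, hx, hx0⟩ := exists_zero_left_of_deriv_pos (continuous_heatVal_space q t) hz0
          (hasDerivAt_heatVal q t z) hz1 (hy.2.trans hwz) hypos
        exact ⟨x, ⟨by linarith [hx.1, hy.1], by linarith [hx.2, hz.2]⟩, hx.2.ne, hx0⟩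
  · rcases Nat.even_or_odd' m with ⟨k, rfl | rfl⟩
    · exact wallR ((hm.eventually_sides_even (even_two_mul _)).mono fun _ h => by
        rw [hneg]; linarith [h.2])
    · exact wallR ((hm.eventually_sides_odd ⟨k, rfl⟩).mono fun _ h => by
        rw [hneg]; linarith [h.2])

/-! ### Singular times and continuation backward in time -/

/-- The times in `[0, T]` at which the heat flow of `q` has a multiple zero. -/
def singularTimes (q : ℝ[X]) (T : ℝ) : Set ℝ :=
  {t ∈ Icc 0 T | ∃ x, heatVal q t x = 0 ∧ heatVal (derivative q) t x = 0}

/-- Multiple zeros are isolated in time and, on bounded time intervals, confined to a compact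
set. -/
theorem finite_singularTimes {q : ℝ[X]} (hq : q ≠ 0) (T : ℝ) : (singularTimes q T).Finite := by
  obtain ⟨M, -, hM⟩ := exists_bound_heatVal_zeros hq 0 T
  let S : Set (ℝ × ℝ) := {z | heatVal q z.1 z.2 = 0 ∧ heatVal (derivative q) z.1 z.2 = 0}
  have hK : IsCompact (Icc (0 : ℝ) T ×ˢ Icc (-M) M) := isCompact_Icc.prod isCompact_Icc
  have hfin : (Prod.fst '' (Icc (0 : ℝ) T ×ˢ Icc (-M) M ∩ S)).Finite := by
    refine hK.induction_on (p := fun A => (Prod.fst '' (A ∩ S)).Finite) (by simp) ?_ ?_ ?_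
    · exact fun A B hAB hB => hB.subset (image_mono (inter_subset_inter_left _ hAB))
    · intro A B hA hB
      rw [union_inter_distrib_right, image_union]
      exact hA.union hB
    · rintro ⟨s, c⟩ _
      refine ⟨_, mem_nhdsWithin_of_mem_nhds ((eventually_not_singular_left hq s c).and
        (eventually_not_singular_right hq s c)), (finite_singleton s).subset ?_⟩
      rintro _ ⟨z, ⟨⟨hz1, hz2⟩, hzS⟩, rfl⟩
      by_contra hne
      rcases lt_or_gt_of_ne hne with hlt | hgt
      · exact hz1 hlt hzS
      · exact hz2 hgt hzS
  refine hfin.subset ?_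
  rintro t ⟨ht, x, hx0, hx1⟩
  exact ⟨(t, x), ⟨⟨ht, (abs_lt.1 (hM t ht x hx0)).imp le_of_lt le_of_lt⟩, hx0, hx1⟩, rfl⟩

/-- Every zero at a positive time can be followed back to time `0`. -/
theorem exists_branch_backward {q : ℝ[X]} (hq : q ≠ 0) {T : ℝ} {b c : ℝ} (hb : 0 ≤ b)
    (hbT : b ≤ T) (h0 : heatVal q b c = 0) :
    ∃ y, ZeroBranch (heatVal q) (Icc 0 b) y ∧ y b = c := by
  have hR := regularFamily_heatVal hq
  obtain ⟨M, hM0, hM⟩ := exists_bound_heatVal_zeros hq 0 T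
  -- Induction on the number of singular times before `b`.
  induction hn : (singularTimes q T ∩ Ioo 0 b).ncard using Nat.strong_induction_on
    generalizing b c with
  | _ n ih =>
    rcases hb.eq_or_lt with rfl | hbpos
    · refine ⟨fun _ => c, ⟨continuousOn_const, fun t ht => ?_⟩, rfl⟩
      rw [Icc_self, mem_singleton_iff] at ht
      rwa [ht]
    have hfin : (singularTimes q T ∩ Ioo 0 b).Finite :=
      (finite_singularTimes hq T).subset inter_subset_left
    -- The last singular time before `b`, or `0`.
    obtain ⟨a, ha0, hab, ha, hreg⟩ : ∃ a, 0 ≤ a ∧ a < b ∧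
        (a = 0 ∨ a ∈ singularTimes q T ∩ Ioo 0 b) ∧ ∀ t ∈ Ioo a b, t ∉ singularTimes q T := by
      rcases (singularTimes q T ∩ Ioo 0 b).eq_empty_or_nonempty with he | hne
      · exact ⟨0, le_rfl, hbpos, Or.inl rfl, fun t ht hts =>
          (he ▸ (⟨hts, ht⟩ : t ∈ singularTimes q T ∩ Ioo 0 b) : t ∈ (∅ : Set ℝ))⟩
      · obtain ⟨a, ha, hmax⟩ := hfin.exists_maximalFor id _ hne
        refine ⟨a, ha.2.1.le, ha.2.2, Or.inr ha, fun t ht hts => ?_⟩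
        have := hmax ⟨hts, ha.2.1.trans ht.1, ht.2⟩ ht.1.le
        exact ht.1.not_ge this
    -- Near `(b, c)`, a short branch ending at `c`.
    obtain ⟨δ, hδ, -, ε, hε, hiso, hbox⟩ := hR.exists_isolating_box b c
      (eventually_not_singular_left hq b c) one_pos
    obtain ⟨t₁, ⟨z, hz, hz0⟩, ht₁⟩ := ((eventually_exists_zero_left hq h0 hδ).and
      (Ioo_mem_nhdsLT (max_lt hab (by linarith : b - ε < b)))).exists
    have hat₁ : a < t₁ := (le_max_left _ _).trans_lt ht₁.1
    have hεt₁ : b - ε < t₁ := (le_max_right _ _).trans_lt ht₁.1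
    have hsub : ∀ τ ∈ Icc (b - ε) b, τ ∈ Icc (b - ε) (b + ε) := fun τ hτ =>
      ⟨hτ.1, by linarith [hτ.2]⟩
    obtain ⟨y₁, hy₁t, hy₁, hy₁I⟩ := hR.exists_branch_through (a := b - ε) (b := b)
      ⟨hεt₁, ht₁.2⟩ (fun τ hτ => (hbox τ (hsub τ hτ)).1) (fun τ hτ => (hbox τ (hsub τ hτ)).2.1)
      (fun τ hτ x hx h1 h2 => (hbox τ (hsub τ (Ioo_subset_Icc_self hτ))).2.2 x
        (Ioo_subset_Icc_self hx) hτ.2 ⟨h1, h2⟩) hz hz0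
    have hbb : b ∈ Icc (b - ε) b := ⟨by linarith, le_rfl⟩
    have hy₁b : y₁ b = c := hiso _ (Ioo_subset_Icc_self (hy₁I b hbb)) (hy₁.zero b hbb)
    -- Continue to time `a` inside a box that contains all zeros.
    have hT : ∀ τ ∈ Icc a b, τ ∈ Icc 0 T := fun τ hτ => ⟨ha0.trans hτ.1, hτ.2.trans hbT⟩
    have habs := abs_lt.1 (hM t₁ (hT t₁ ⟨hat₁.le, ht₁.2.le⟩) z hz0)
    obtain ⟨y₂, hy₂t, hy₂, -⟩ := hR.exists_branch_through (a := a) (b := b) (α := -M) (β := M)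
      ⟨hat₁, ht₁.2⟩
      (fun τ hτ hcon => by
        have := hM τ (hT τ hτ) _ hcon
        rw [abs_neg, abs_of_pos hM0] at this
        exact lt_irrefl _ this)
      (fun τ hτ hcon => by
        have := hM τ (hT τ hτ) _ hcon
        rw [abs_of_pos hM0] at this
        exact lt_irrefl _ this)
      (fun τ hτ x _ h1 h2 => hreg τ hτ ⟨hT τ (Ioo_subset_Icc_self hτ), x, h1, h2⟩)
      ⟨habs.1, habs.2⟩ hz0
    obtain ⟨y₃, hy₃, hy₃a, hy₃b⟩ := (hy₂.mono (Icc_subset_Icc_right ht₁.2.le)).exists_glue hat₁.le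
      ht₁.2.le (hy₁.mono (Icc_subset_Icc_left hεt₁.le)) (hy₂t.trans hy₁t.symm)
    have hy₃c : y₃ b = c := by rw [hy₃b ⟨ht₁.2.le, le_rfl⟩, hy₁b]
    rcases ha with rfl | ha
    · exact ⟨y₃, hy₃, hy₃c⟩
    have hlt : (singularTimes q T ∩ Ioo 0 a).ncard < n := by
      rw [← hn]
      refine ncard_lt_ncard ⟨inter_subset_inter_right _ (Ioo_subset_Ioo_right hab.le), ?_⟩ hfin
      intro hsubset
      exact lt_irrefl a (hsubset ha).2.2
    obtain ⟨y₄, hy₄, hy₄a⟩ := ih _ hlt ha0 (hab.le.trans hbT) (hy₃.zero a ⟨le_rfl, hab.le⟩) rfl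
    obtain ⟨w, hw, -, hwb⟩ := hy₄.exists_glue ha0 hab.le hy₃ hy₄a
    exact ⟨w, hw, by rw [hwb ⟨hab.le, le_rfl⟩, hy₃c]⟩

/-! ### Yuille–Poggio curves as branches of zeros of the derivative -/

theorem ypVelocity_eq (p : ℝ[X]) {t : ℝ} (ht : 0 ≤ t) (x : ℝ) :
    ypVelocity p t x = -(heatVal (derivative (derivative (derivative p))) t x / 2) /
      heatVal (derivative (derivative p)) t x := by
  rw [ypVelocity, heatDeriv_eq_heatVal p 3 ht, heatDeriv_eq_heatVal p 2 ht]
  simp only [Function.iterate_succ_apply, Function.iterate_zero, id]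
  rw [← neg_div, div_div]

/-- `p_x` is constant along integral curves of the Yuille–Poggio equation. -/
theorem IsYPCurve.heatVal_derivative_eq {p : ℝ[X]} {h T : ℝ} {x : ℝ → ℝ} (hx : IsYPCurve p h T x)
    {t : ℝ} (ht : t ∈ Icc 0 T) : heatVal (derivative p) t (x t) = heatVal (derivative p) 0 h := by
  have hcont : ContinuousOn (fun τ => heatVal (derivative p) τ (x τ)) (Icc 0 t) :=
    (continuous_heatVal _).comp_continuousOn
      (continuousOn_id.prodMk (hx.continuousOn.mono (Icc_subset_Icc_right ht.2)))
  have := integral_eq_of_hasDerivAt_off_countable_of_le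
    (fun τ => heatVal (derivative p) τ (x τ)) (fun _ => (0 : ℝ)) ht.1
    hx.finite_singular.countable hcont (fun τ hτ => ?_) (by simp)
  · rw [intervalIntegral.integral_zero, hx.initial] at this
    linarith
  · have hτ' : τ ∈ Ioo 0 T := ⟨hτ.1.1, hτ.1.2.trans_le ht.2⟩
    have hne : heatDeriv p 2 τ (x τ) ≠ 0 := fun h0 => hτ.2 ⟨hτ', h0⟩
    refine (hasDerivAt_heatVal_comp _ (hx.equation τ hτ' hne)).congr_deriv ?_
    rw [heatDeriv_eq_heatVal p 2 hτ'.1.le] at hne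
    simp only [Function.iterate_succ_apply, Function.iterate_zero, id] at hne
    rw [ypVelocity_eq p hτ'.1.le]
    field_simp
    ring

/-- A branch of zeros of `p_x` solves the Yuille–Poggio equation at its nonsingular points. -/
theorem ZeroBranch.hasDerivWithinAt_ypVelocity {p : ℝ[X]} (hp : derivative p ≠ 0) {I : Set ℝ}
    {y : ℝ → ℝ} (hy : ZeroBranch (heatVal (derivative p)) I y) {t : ℝ} (ht : t ∈ I) (ht0 : 0 ≤ t)
    (hne : heatVal (derivative (derivative p)) t (y t) ≠ 0) :
    HasDerivWithinAt y (ypVelocity p t (y t)) I t := by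
  rw [ypVelocity_eq p ht0]
  exact (regularFamily_heatVal hp).hasDerivWithinAt_branch hy ht hne
    (hasDerivAt_heatVal_time _ t (y t))

theorem ZeroBranch.isYPCurve {p : ℝ[X]} (hp : derivative p ≠ 0) {T : ℝ} {y : ℝ → ℝ}
    (hy : ZeroBranch (heatVal (derivative p)) (Icc 0 T) y) : IsYPCurve p (y 0) T y where
  continuousOn := hy.continuousOn
  initial := rfl
  finite_singular := (finite_singularTimes hp T).subset fun t ht => by
    have hI := Ioo_subset_Icc_self ht.1
    refine ⟨hI, y t, hy.zero t hI, ?_⟩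
    rw [← ht.2, heatDeriv_eq_heatVal p 2 hI.1]
    rfl
  equation t ht hne := by
    rw [heatDeriv_eq_heatVal p 2 ht.1.le] at hne
    exact (hy.hasDerivWithinAt_ypVelocity hp (Ioo_subset_Icc_self ht) ht.1.le hne).hasDerivAt
      (Icc_mem_nhds ht.1 ht.2)

/-- At a global minimizer, `p'` vanishes to odd order, from negative to positive values. -/
theorem exists_positiveOfOrder_derivative_of_isMinOn {p : ℝ[X]} (hp : derivative p ≠ 0) {c : ℝ}
    (hc : IsMinOn (fun x => p.eval x) univ c) :
    ∃ k, PositiveOfOrder (derivative p) c (2 * k + 1) := by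
  have hder : derivative (p - C (p.eval c)) = derivative p := by simp
  have hf : p - C (p.eval c) ≠ 0 := fun h => hp (by rw [← hder, h, derivative_zero])
  have hnn : ∀ x, 0 ≤ (p - C (p.eval c)).eval x := fun x => by
    simpa using hc (mem_univ x)
  have hc0 : (p - C (p.eval c)).eval c = 0 := by simp
  obtain ⟨m, hm | hm⟩ := exists_positiveOfOrder hf c
  · rcases Nat.even_or_odd' m with ⟨k, rfl | rfl⟩
    · obtain _ | k := k
      · exact absurd hc0 hm.eval_pos.ne'
      · exact ⟨k, hder ▸ PositiveOfOrder.derivative (m := 2 * k + 1) hm⟩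
    · obtain ⟨δ, hδ, -⟩ := (hm.eventually_sides_odd ⟨k, rfl⟩).exists
      exact absurd (hnn _) hδ.not_ge
  · exfalso
    have hs : ∃ δ, 0 < (-(p - C (p.eval c))).eval (c + δ) := by
      rcases Nat.even_or_odd m with h | h
      · obtain ⟨δ, -, hδ⟩ := (hm.eventually_sides_even h).exists
        exact ⟨δ, hδ⟩
      · obtain ⟨δ, -, hδ⟩ := (hm.eventually_sides_odd h).exists
        exact ⟨δ, hδ⟩
    obtain ⟨δ, hδ⟩ := hs
    rw [eval_neg] at hδ
    linarith [hnn (c + δ)]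

/-- Near a point where `p_xx > 0` for small positive times, two branches of zeros of `p_x` with
the same initial point coincide for a short time. -/
theorem eventually_eq_of_eq_zero {p : ℝ[X]} {T c : ℝ} (hT : 0 < T)
    (hpos : ∀ᶠ z in 𝓝 ((0 : ℝ), c), 0 < z.1 → 0 < heatVal (derivative (derivative p)) z.1 z.2)
    {x y : ℝ → ℝ} (hx : ZeroBranch (heatVal (derivative p)) (Icc 0 T) x)
    (hy : ZeroBranch (heatVal (derivative p)) (Icc 0 T) y) (hx0 : x 0 = c) (hy0 : y 0 = c) :
    ∀ᶠ t in 𝓝[>] 0, x t = y t := by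
  obtain ⟨δ, hδ, hδ0 : 0 < δ⟩ := ((eventually_forall_Icc_of_nhds_prod hpos).and
    self_mem_nhdsWithin).exists
  have near : ∀ w : ℝ → ℝ, ZeroBranch (heatVal (derivative p)) (Icc 0 T) w → w 0 = c →
      ∀ᶠ t in 𝓝[>] 0, w t ∈ Icc (c - δ) (c + δ) := by
    intro w hw hw0
    have h1 : Tendsto w (𝓝[>] 0) (𝓝 c) := by
      have := hw.continuousOn 0 ⟨le_rfl, hT.le⟩
      rw [ContinuousWithinAt, hw0] at this
      exact this.mono_left (nhdsWithin_le_of_mem (Icc_mem_nhdsGT hT))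
    exact h1.eventually (Icc_mem_nhds (by linarith) (by linarith))
  filter_upwards [near x hx hx0, near y hy hy0, mem_nhdsWithin_of_mem_nhds hδ, Icc_mem_nhdsGT hT,
    self_mem_nhdsWithin] with t hxt hyt ht htI (ht0 : 0 < t)
  have hmono : StrictMonoOn (heatVal (derivative p) t) (Icc (c - δ) (c + δ)) := by
    refine strictMonoOn_of_deriv_pos (convex_Icc _ _) (continuous_heatVal_space _ t).continuousOn
      fun w hw => ?_
    rw [(hasDerivAt_heatVal _ t w).deriv]
    exact ht w (interior_subset hw) ht0
  exact hmono.injOn hxt hyt (by rw [hx.zero t htI, hy.zero t htI])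

/-- A branch which is regular at positive times is determined, back to its initial point, by its
end point. -/
theorem RegularFamily.initial_eq_of_end_eq {F G : ℝ → ℝ → ℝ} (h : RegularFamily F G) {T : ℝ}
    (hT : 0 ≤ T) {x y : ℝ → ℝ} (hx : ZeroBranch F (Icc 0 T) x) (hy : ZeroBranch F (Icc 0 T) y)
    (hG : ∀ t ∈ Ioc 0 T, G t (x t) ≠ 0) (he : x T = y T) : x 0 = y 0 := by
  rcases hT.eq_or_lt with rfl | hT
  · exact he
  have heq := h.eqOn_of_regular isPreconnected_Ioc (hx.mono Ioc_subset_Icc_self)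
    (hy.mono Ioc_subset_Icc_self) hG ⟨hT, le_rfl⟩ he
  have lim : ∀ w : ℝ → ℝ, ZeroBranch F (Icc 0 T) w → Tendsto w (𝓝[>] 0) (𝓝 (w 0)) := fun w hw =>
    (hw.continuousOn 0 ⟨le_rfl, hT.le⟩).tendsto.mono_left
      (nhdsWithin_le_of_mem (Icc_mem_nhdsGT hT))
  refine tendsto_nhds_unique (lim x hx) ((lim y hy).congr' ?_)
  filter_upwards [Ioc_mem_nhdsGT hT] with t ht using (heq ht).symm

/-- When `p(·, t)` is convex it has only one critical point. -/
theorem eq_of_critical_of_convexOn {p : ℝ[X]} (hp : derivative p ≠ 0) {t : ℝ}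
    (hconv : ConvexOn ℝ univ (heatVal p t)) {a b : ℝ} (ha : heatVal (derivative p) t a = 0)
    (hb : heatVal (derivative p) t b = 0) : a = b := by
  wlog hab : a ≤ b generalizing a b
  · exact (this hb ha (not_le.1 hab).le).symm
  by_contra hne
  have hlt : a < b := lt_of_le_of_ne hab hne
  have hd : deriv (heatVal p t) = heatVal (derivative p) t :=
    funext fun x => (hasDerivAt_heatVal p t x).deriv
  have hmono := hconv.monotoneOn_deriv fun x _ => (hasDerivAt_heatVal p t x).differentiableAt
  rw [hd] at hmono
  have hR : ∀ᶠ x in 𝓝[>] a, heatVal (derivative p) t x ≠ 0 ∧ x ∈ Ioo a b :=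
    (((regularFamily_heatVal hp).isolated t a).filter_mono
      (nhdsWithin_mono a fun x hx => ne_of_gt hx)).and (Ioo_mem_nhdsGT hlt)
  obtain ⟨x, hx0, hx⟩ := hR.exists
  refine hx0 (le_antisymm ?_ ?_)
  · rw [← hb]; exact hmono (mem_univ x) (mem_univ b) hx.2.le
  · rw [← ha]; exact hmono (mem_univ a) (mem_univ x) hx.1.le

/-- The branch of zeros of `p_x` starting at a minimizer `c` can be followed as a regular branch
until time `t₀`, or until it runs into a singular point. -/
theorem exists_branch_from_minimizer {p : ℝ[X]} (hp : derivative p ≠ 0) {c : ℝ} {k : ℕ}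
    (hk : PositiveOfOrder (derivative p) c (2 * k + 1))
    (hpos : ∀ᶠ z in 𝓝 ((0 : ℝ), c), 0 < z.1 → 0 < heatVal (derivative (derivative p)) z.1 z.2)
    {t₀ : ℝ} (ht₀ : 0 < t₀) :
    ∃ s ∈ Ioc 0 t₀, ∃ x, ZeroBranch (heatVal (derivative p)) (Icc 0 s) x ∧ x 0 = c ∧
      (∀ t ∈ Ioo 0 s, 0 < heatVal (derivative (derivative p)) t (x t)) ∧
      (s = t₀ ∨ heatVal (derivative (derivative p)) s (x s) = 0) := by
  have hR := regularFamily_heatVal hp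
  obtain ⟨δ₀, hδ₀, hsides⟩ := mem_nhdsGT_iff_exists_Ioo_subset.1
    (hk.eventually_sides_odd ⟨k, rfl⟩)
  obtain ⟨δ, hδ, hδδ, ε, hε, hiso, hbox⟩ := hR.exists_isolating_box 0 c hpos hδ₀
  have hside := hsides ⟨hδ, hδδ⟩
  rw [zero_sub, zero_add] at hbox
  have hl : heatVal (derivative p) 0 (c - δ) < 0 := by
    rw [heatVal, heatPoly_time_zero]; exact hside.1
  have hr : 0 < heatVal (derivative p) 0 (c + δ) := by
    rw [heatVal, heatPoly_time_zero]; exact hside.2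
  have hwalls : ∀ᶠ t in 𝓝 (0 : ℝ),
      heatVal (derivative p) t (c - δ) < 0 ∧ 0 < heatVal (derivative p) t (c + δ) :=
    ((continuous_heatVal_time _ (c - δ)).continuousAt.eventually_lt_const hl).and
      ((continuous_heatVal_time _ (c + δ)).continuousAt.eventually_const_lt hr)
  obtain ⟨t₁, ⟨hl₁, hr₁⟩, ht₁0, ht₁⟩ := ((hwalls.filter_mono nhdsWithin_le_nhds).and
    (Ioo_mem_nhdsGT (lt_min hε ht₀))).exists
  obtain ⟨z, hz, hz0⟩ := intermediate_value_Ioo (by linarith : c - δ ≤ c + δ)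
    (continuous_heatVal_space (derivative p) t₁).continuousOn ⟨hl₁, hr₁⟩
  have hsub : ∀ t ∈ Icc 0 ε, t ∈ Icc (-ε) ε := fun t ht => ⟨by linarith [ht.1], ht.2⟩
  have hεt : t₁ < ε := ht₁.trans_le (min_le_left _ _)
  have ht₁t₀ : t₁ < t₀ := ht₁.trans_le (min_le_right _ _)
  obtain ⟨y, hyt, hy, hyI⟩ := hR.exists_branch_through (a := 0) (b := ε) ⟨ht₁0, hεt⟩
    (fun t ht => (hbox t (hsub t ht)).1) (fun t ht => (hbox t (hsub t ht)).2.1)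
    (fun t ht x hx _ => ((hbox t (hsub t (Ioo_subset_Icc_self ht))).2.2 x
      (Ioo_subset_Icc_self hx) ht.1).ne') hz hz0
  have h0ε : (0 : ℝ) ∈ Icc 0 ε := ⟨le_rfl, hε.le⟩
  have hy0 : y 0 = c := hiso _ (Ioo_subset_Icc_self (hyI 0 h0ε)) (hy.zero 0 h0ε)
  have hypos : ∀ t ∈ Ioc 0 t₁, 0 < heatVal (derivative (derivative p)) t (y t) := fun t ht => by
    have htε : t ∈ Icc 0 ε := ⟨ht.1.le, ht.2.trans hεt.le⟩
    exact (hbox t (hsub t htε)).2.2 _ (Ioo_subset_Icc_self (hyI t htε)) ht.1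
  obtain ⟨M, hM0, hM⟩ := exists_bound_heatVal_zeros hp 0 t₀
  have hwall : ∀ t ∈ Icc t₁ t₀, ∀ w, |w| = M → heatVal (derivative p) t w ≠ 0 :=
    fun t ht w hw hcon => (hM t ⟨ht₁0.le.trans ht.1, ht.2⟩ w hcon).ne hw
  have habs := abs_lt.1 (hM t₁ ⟨ht₁0.le, ht₁t₀.le⟩ z hz0)
  obtain ⟨s, hs, x, hx₁, hx, -, hxreg, hend⟩ := hR.exists_branch_until_singular
    (α := -M) (β := M) ht₁t₀.le
    (fun t ht => hwall t ht _ (by rw [abs_neg, abs_of_pos hM0]))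
    (fun t ht => hwall t ht _ (abs_of_pos hM0)) ⟨habs.1, habs.2⟩ hz0
    (hyt ▸ (hypos t₁ ⟨ht₁0, le_rfl⟩).ne')
  obtain ⟨w, hw, hwy, hwx⟩ := (hy.mono (Icc_subset_Icc_right hεt.le)).exists_glue ht₁0.le hs.1 hx
    (hyt.trans hx₁.symm)
  have hwpos : ∀ t ∈ Ico t₁ s, 0 < heatVal (derivative (derivative p)) t (w t) := by
    intro t ht
    have h1 := pos_of_continuousOn_Ico (f := fun τ => heatVal (derivative (derivative p)) τ (x τ))
      ((continuous_heatVal _).comp_continuousOn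
      (continuousOn_id.prodMk (hx.continuousOn.mono Ico_subset_Icc_self))) hxreg
      (by rw [hx₁, ← hyt]; exact hypos t₁ ⟨ht₁0, le_rfl⟩) t ht
    rwa [hwx (Ico_subset_Icc_self ht)]
  refine ⟨s, ⟨ht₁0.trans_le hs.1, hs.2⟩, w, hw, by rw [hwy ⟨le_rfl, ht₁0.le⟩, hy0],
    fun t ht => ?_, ?_⟩
  · rcases le_or_gt t₁ t with hle | hlt
    · exact hwpos t ⟨hle, ht.2⟩
    · rw [hwy ⟨ht.1.le, hlt.le⟩]
      exact hypos t ⟨ht.1, hlt.le⟩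
  · rwa [hwx ⟨hs.1, le_rfl⟩]

/-- If the increasing branch from `c` runs into a singular point, then another branch reaches the
same point from a different starting point. -/
theorem exists_other_branch_of_singular {p : ℝ[X]} (hp : derivative p ≠ 0) {c s : ℝ} (hs : 0 < s)
    (hpos : ∀ᶠ z in 𝓝 ((0 : ℝ), c), 0 < z.1 → 0 < heatVal (derivative (derivative p)) z.1 z.2)
    {x : ℝ → ℝ} (hx : ZeroBranch (heatVal (derivative p)) (Icc 0 s) x) (hx0 : x 0 = c)
    (hxpos : ∀ t ∈ Ioo 0 s, 0 < heatVal (derivative (derivative p)) t (x t))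
    (hsing : heatVal (derivative (derivative p)) s (x s) = 0) :
    ∃ y, ZeroBranch (heatVal (derivative p)) (Icc 0 s) y ∧ y s = x s ∧ y 0 ≠ c := by
  have hR := regularFamily_heatVal hp
  have hss : s ∈ Icc 0 s := ⟨hs.le, le_rfl⟩
  obtain ⟨δ, hδ, -, ε, hε, hiso, hbox⟩ := hR.exists_isolating_box s (x s)
    (eventually_not_singular_left hp s (x s)) one_pos
  have hlim : Tendsto (fun t => (t, x t)) (𝓝[<] s) (𝓝 (s, x s)) :=
    (tendsto_nhdsWithin_of_tendsto_nhds tendsto_id).prodMk_nhds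
      ((hx.continuousOn s hss).tendsto.mono_left (nhdsWithin_le_of_mem (Icc_mem_nhdsLT hs)))
  obtain ⟨t, ht, htm⟩ := ((hlim.eventually (eventually_exists_other_zero hp (hx.zero s hss) hsing
    hδ)).and (Ioo_mem_nhdsLT (max_lt hs (by linarith : s - ε < s)))).exists
  have ht0 : 0 < t := (le_max_left _ _).trans_lt htm.1
  have htε : s - ε < t := (le_max_right _ _).trans_lt htm.1
  obtain ⟨z, hz, hzx, hz0⟩ := ht htm.2 (hx.zero t ⟨ht0.le, htm.2.le⟩) (hxpos t ⟨ht0, htm.2⟩)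
  have hsub : ∀ τ ∈ Icc (s - ε) s, τ ∈ Icc (s - ε) (s + ε) := fun τ hτ =>
    ⟨hτ.1, by linarith [hτ.2]⟩
  obtain ⟨y₁, hy₁t, hy₁, hy₁I⟩ := hR.exists_branch_through (a := s - ε) (b := s) ⟨htε, htm.2⟩
    (fun τ hτ => (hbox τ (hsub τ hτ)).1) (fun τ hτ => (hbox τ (hsub τ hτ)).2.1)
    (fun τ hτ w hw h1 h2 => (hbox τ (hsub τ (Ioo_subset_Icc_self hτ))).2.2 w
      (Ioo_subset_Icc_self hw) hτ.2 ⟨h1, h2⟩) hz hz0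
  have hsε : s ∈ Icc (s - ε) s := ⟨by linarith, le_rfl⟩
  have hy₁s : y₁ s = x s := hiso _ (Ioo_subset_Icc_self (hy₁I s hsε)) (hy₁.zero s hsε)
  obtain ⟨y₂, hy₂, hy₂t⟩ := exists_branch_backward hp ht0.le le_rfl hz0
  obtain ⟨y, hy, hyl, hyr⟩ := hy₂.exists_glue ht0.le htm.2.le
    (hy₁.mono (Icc_subset_Icc_left htε.le)) (hy₂t.trans hy₁t.symm)
  refine ⟨y, hy, by rw [hyr ⟨htm.2.le, le_rfl⟩, hy₁s], fun hy0 => hzx ?_⟩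
  -- Branches from the same minimizer coincide at first, hence as long as `x` is regular.
  obtain ⟨τ, hτ, hτs⟩ := ((eventually_eq_of_eq_zero hs hpos hx hy hx0 hy0).and
    (Ioo_mem_nhdsGT hs)).exists
  have heq := hR.eqOn_of_regular isPreconnected_Ioo (hx.mono Ioo_subset_Icc_self)
    (hy.mono Ioo_subset_Icc_self) (fun t ht => (hxpos t ht).ne') hτs hτ
  show z = x t
  rw [heq ⟨ht0, htm.2⟩, hyl ⟨ht0.le, le_rfl⟩, hy₂t]

/-- A global minimizer `xstar` of `p` is obtained by following the Yuille–Poggio equation backward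
from the global minimizer of the convex polynomial `p(·,t₀)` iff it lies in the escape zone. -/
theorem mainTheorem1 (p : ℝ[X]) (hdeg : 0 < p.natDegree) (heven : Even p.natDegree)
    (hlead : 0 < p.leadingCoeff)
    (t₀ : ℝ) (ht₀ : 0 ≤ t₀) (hconv : ConvexOn ℝ univ (heatEvolution p t₀))
    (xmin : ℝ) (hxmin : IsMinOn (heatEvolution p t₀) univ xmin)
    (xstar : ℝ) (hxstar : IsMinOn (fun x => p.eval x) univ xstar) :
    ReachedBackward p t₀ xmin xstar ↔ xstar ∈ escapeZone p := by
  have hp : derivative p ≠ 0 := fun h => hdeg.ne' (derivative_eq_zero.1 h)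
  have hR := regularFamily_heatVal hp
  rw [heatEvolution_eq_heatVal p ht₀] at hconv hxmin
  have hmin0 : heatVal (derivative p) t₀ xmin = 0 :=
    (hxmin.isLocalMin univ_mem).hasDerivAt_eq_zero (hasDerivAt_heatVal p t₀ xmin)
  have huniq : ∀ a, heatVal (derivative p) t₀ a = 0 → a = xmin := fun a ha =>
    eq_of_critical_of_convexOn hp hconv ha hmin0
  obtain ⟨k, hk⟩ := exists_positiveOfOrder_derivative_of_isMinOn hp hxstar
  have hstar0 : heatVal (derivative p) 0 xstar = 0 := by
    rw [heatVal, heatPoly_time_zero]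
    exact hk.eval_eq_zero
  have hpos : ∀ᶠ z in 𝓝 ((0 : ℝ), xstar), 0 < z.1 →
      0 < heatVal (derivative (derivative p)) z.1 z.2 := by
    refine eventually_heatVal_pos_of_even (m := k) ?_
    rw [heatPoly_time_zero]
    exact PositiveOfOrder.derivative hk
  constructor
  · rintro ⟨x, hxc, hxt₀, hx0, hxeq⟩
    have hxreg : ∀ t ∈ Ioc 0 t₀, heatVal (derivative (derivative p)) t (x t) ≠ 0 := by
      intro t ht
      have := (hxeq t ht).1
      rwa [heatDeriv_eq_heatVal p 2 ht.1.le] at this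
    have hxYP : IsYPCurve p xstar t₀ x := by
      refine ⟨hxc, hx0, ?_, fun t ht _ => ?_⟩
      · refine finite_empty.subset fun t ht => ?_
        exact (hxeq t (Ioo_subset_Ioc_self ht.1)).1 ht.2
      · exact (hxeq t (Ioo_subset_Ioc_self ht)).2.hasDerivAt (Icc_mem_nhds ht.1 ht.2)
    have hx : ZeroBranch (heatVal (derivative p)) (Icc 0 t₀) x :=
      ⟨hxc, fun t ht => (hxYP.heatVal_derivative_eq ht).trans hstar0⟩
    intro c' hc'
    rw [Set.disjoint_left]
    rintro ⟨w, T⟩ ⟨hT : 0 ≤ T, x', hx', hx'T : x' T = w⟩ ⟨-, y, hy, hyT : y T = w⟩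
    change IsYPCurve p xstar T x' at hx'
    change IsYPCurve p c' T y at hy
    have hTT : T ∈ Icc 0 T := ⟨hT, le_rfl⟩
    have hbx' : ZeroBranch (heatVal (derivative p)) (Icc 0 T) x' :=
      ⟨hx'.continuousOn, fun t ht => (hx'.heatVal_derivative_eq ht).trans hstar0⟩
    -- `y` meets `x'`, so it lies on the same level set of `p_x`.
    have hby : ZeroBranch (heatVal (derivative p)) (Icc 0 T) y := by
      refine ⟨hy.continuousOn, fun t ht => ?_⟩
      rw [hy.heatVal_derivative_eq ht, ← hy.heatVal_derivative_eq hTT, hyT, ← hx'T]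
      exact hbx'.zero T hTT
    refine hc' ?_
    rw [← hy.initial, ← hx0]
    rcases le_or_gt t₀ T with hle | hlt
    · refine (hR.initial_eq_of_end_eq ht₀ hx (hby.mono (Icc_subset_Icc_right hle)) hxreg ?_).symm
      rw [hxt₀, huniq (y t₀) (hby.zero t₀ ⟨ht₀, hle⟩)]
    · have hxT := hx.mono (Icc_subset_Icc_right hlt.le)
      have hxregT : ∀ t ∈ Ioc 0 T, heatVal (derivative (derivative p)) t (x t) ≠ 0 := fun t ht =>
        hxreg t ⟨ht.1, ht.2.trans hlt.le⟩
      refine (hR.initial_eq_of_end_eq hT hxT hby hxregT ?_).symm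
      rw [hyT, ← hx'T]
      rcases hT.eq_or_lt with rfl | hTpos
      · rw [hx0, hx'.initial]
      · obtain ⟨τ, hτ, hτI⟩ := ((eventually_eq_of_eq_zero hTpos hpos hxT hbx' hx0
          hx'.initial).and (Ioc_mem_nhdsGT hTpos)).exists
        exact hR.eqOn_of_regular isPreconnected_Ioc (hxT.mono Ioc_subset_Icc_self)
          (hbx'.mono Ioc_subset_Icc_self) hxregT hτI hτ ⟨hTpos, le_rfl⟩
  · intro hesc
    rcases ht₀.eq_or_lt with rfl | ht₀pos
    · refine ⟨fun _ => xmin, continuousOn_const, rfl, (huniq xstar hstar0).symm, fun t ht => ?_⟩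
      exact absurd (ht.1.trans_le ht.2) (lt_irrefl _)
    obtain ⟨s, hs, x, hx, hx0, hxpos, hend⟩ := exists_branch_from_minimizer hp hk hpos ht₀pos
    have hns : heatVal (derivative (derivative p)) s (x s) ≠ 0 := by
      intro hsing
      obtain ⟨y, hy, hys, hy0⟩ := exists_other_branch_of_singular hp hs.1 hpos hx hx0 hxpos hsing
      have hxYP : IsYPCurve p xstar s x := hx0 ▸ hx.isYPCurve hp
      have hmem : (x s, s) ∈ ypCurve p xstar := ⟨hs.1.le, x, hxYP, rfl⟩
      exact Set.disjoint_left.1 (hesc (y 0) hy0) hmem ⟨hs.1.le, y, hy.isYPCurve hp, hys⟩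
    obtain rfl : s = t₀ := hend.resolve_right hns
    refine ⟨x, hx.continuousOn, huniq _ (hx.zero s ⟨ht₀, le_rfl⟩), hx0, fun t ht => ?_⟩
    have hne : heatVal (derivative (derivative p)) t (x t) ≠ 0 := by
      rcases ht.2.eq_or_lt with rfl | hlt
      · exact hns
      · exact (hxpos t ⟨ht.1, hlt⟩).ne'
    refine ⟨?_, hx.hasDerivWithinAt_ypVelocity hp (Ioc_subset_Icc_self ht) ht.1.le hne⟩
    rw [heatDeriv_eq_heatVal p 2 ht.1.le]
    exact hne
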